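/- **Setting.** Let $p:\mathbb R\to\mathbb R$ be a unit-energy pulse ($p\in L^2(\mathbb R)$, $\int p^2=1$) that vanishes outside an interval of length $T_p>0$. Let $W>0$ be the bandwidth, $\beta\ge 0$ the roll-off factor, $T=\frac{1+\beta}{2W}$ the symbol time, $\tau\in(0,1)$ the time-acceleration factor, $P>0$ the signal power, $N_0>0$ the noise power spectral density, and put $\rho=\frac{P}{2WN_0}$ and $c=2WT_p$. For a time-bandwidth product (TBP) $\Omega>0$ let $$N=N(\Omega)=\left\lfloor\frac{\Omega-c}{\tau(1+\beta)}+1\right\rfloor$$ be the number of transmitted symbols (for $\Omega$ large enough that $N\ge1$), let $\lambda_0,\dots,\lambda_{N-1}$ be the eigenvalues of the $N\times N$ symmetric Toeplitz matrix $\mathbf H=(h_{i-j})$ with $h_k=\int_{-\infty}^{\infty}p(t)\,p(t-k\tau T)\,dt$, and let $\sigma_n^2=(\rho\frac{\Omega}{N}\lambda_n)^{-1}$. The $N$-parallel Gaussian channel model of faster-than-Nyquist (FTN) signaling is $\tilde y_n=\tilde x_n+\tilde z_n$, $0\le n<N$, with independent circularly symmetric complex Gaussian noise $\tilde z_n\sim\mathcal{CN}(0,\sigma_n^2)$.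 A constant-power code with $M$ messages consists of codewords $\tilde{\mathbf x}^{(1)},\dots,\tilde{\mathbf x}^{(M)}\in\mathbb C^N$ with $|\tilde x^{(m)}_n|^2=1$ for all $m,n$, and a measurable decoder $\mathbb C^N\to\{1,\dots,M\}$; its rate is $\frac{1}{\Omega}\log_2M$ bps/Hz, and its average block error rate (BLER) is the probability of a decoding error when the $M$ messages are equally likely. The maximum channel coding rate $R^*(\Omega,P_e)$ is the supremum of the rates of the constant-power codes of average BLER at most $P_e$. Let $Q(x)=\mathbb P[\mathcal N(0,1)>x]$, let $Q^{-1}$ be its inverse function, and let $$C_{\rm NA}=\frac1\Omega\sum_{n=0}^{N-1}\log_2\Bigl(1+\frac1{\sigma_n^2}\Bigr),\qquad V_{\rm NA}=\frac1\Omega\sum_{n=0}^{N-1}\Bigl(1-\frac{1}{(1+\frac1{\sigma_n^2})^2}\Bigr),$$ $$R_{\rm NA}(\Omega,P_e)=C_{\rm NA}-\sqrt{\frac{V_{\rm NA}}{\Omega}}\,\log_2(e)\,Q^{-1}(P_e)+\frac{\log_2\Omega}{2\Omega}.$$ **Proposition (normal approximation for FTN).** Fix $p,T_p,W,\beta,\tau<1,P,N_0$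 as above and $0<P_e<1$. Under the constant power constraint, as $\Omega\to\infty$, $$R^*(\Omega,P_e)\le R_{\rm NA}(\Omega,P_e)+\mathcal O\!\left(\frac1\Omega\right),$$ that is, there are constants $K$ and $\Omega_0>0$, depending only on $p,T_p,W,\beta,\tau,P,N_0,P_e$, such that $R^*(\Omega,P_e)\le R_{\rm NA}(\Omega,P_e)+K/\Omega$ for all real $\Omega\ge\Omega_0$. Moreover, for all $\Omega\ge\Omega_0$, the normal approximation can be stated in terms of the BLER: for every real $R$, $R=R_{\rm NA}(\Omega,P_e)$ if and only if $$P_e=Q\!\left(\frac{C_{\rm NA}-R+\frac{\log_2\Omega}{2\Omega}}{\sqrt{V_{\rm NA}/\Omega}\,\log_2(e)}\right).$$ -/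

import Mathlib

open MeasureTheory ProbabilityTheory

noncomputable section

/-- The parameters of a faster-than-Nyquist (FTN) signaling system: a real-valued, unit-energy pulse
`p(t)` that vanishes outside an interval of length `Tp`, the bandwidth `W`, the roll-off factor `β`,
the time-acceleration factor `τ < 1`, the average signal power `P` and the noise level `N0`. -/
structure FTNSystem where
  /-- the pulse `p(t)` -/
  pulse : ℝ → ℝ
  /-- the pulse-width -/
  Tp : ℝ
  /-- the bandwidth in Hz -/
  W : ℝ
  /-- the roll-off factor -/
  β : ℝ
  /-- the time-acceleration factor -/
  τ : ℝ
  /-- the average signal power -/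
  P : ℝ
  /-- the power spectral density of the noise -/
  N0 : ℝ
  Tp_pos : 0 < Tp
  W_pos : 0 < W
  β_nonneg : 0 ≤ β
  τ_pos : 0 < τ
  τ_lt_one : τ < 1
  P_pos : 0 < P
  N0_pos : 0 < N0
  pulse_memLp : MemLp pulse 2 volume
  pulse_energy : ∫ t, pulse t ^ 2 = 1
  pulse_timeLimited : ∃ a : ℝ, ∀ t, t ∉ Set.Icc a (a + Tp) → pulse t = 0

/-- The circularly symmetric complex Gaussian law `CN(μ, v)`: independent real and imaginary parts,
each of variance `v / 2`. -/
def complexGaussian (μ : ℂ) (v : ℝ) : Measure ℂ :=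
  ((gaussianReal μ.re (v / 2).toNNReal).prod (gaussianReal μ.im (v / 2).toNNReal)).map
    Complex.measurableEquivRealProd.symm

/-- The law of the output `y = x + z` of `N` parallel complex Gaussian channels with noise variances
`σ2 n`, when the input is `x`. -/
def outputLaw {N : ℕ} (σ2 : Fin N → ℝ) (x : Fin N → ℂ) : Measure (Fin N → ℂ) :=
  Measure.pi fun n => complexGaussian (x n) (σ2 n)

/-- A channel code with `M` equally likely messages for `N` parallel complex channels, under the
constant power constraint `|x_n|² = 1` for every codeword and every `n`. -/
structure ConstantPowerCode (N M : ℕ) where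
  /-- the codeword of each message -/
  encode : Fin M → Fin N → ℂ
  /-- the decision taken at each channel output -/
  decode : (Fin N → ℂ) → Fin M
  measurable_decode : Measurable decode
  constant_power : ∀ m n, ‖encode m n‖ ^ 2 = 1

/-- The average block error rate of a code over the parallel channels with noise variances `σ2`. -/
def ConstantPowerCode.bler {N M : ℕ} (C : ConstantPowerCode N M) (σ2 : Fin N → ℝ) : ℝ :=
  (1 / (M : ℝ)) * ∑ m, (outputLaw σ2 (C.encode m)).real {y | C.decode y ≠ m}

/-- The Gaussian `Q`-function, the complementary cumulative distribution function of `N(0, 1)`. -/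
def gaussianQ (x : ℝ) : ℝ := (gaussianReal 0 1).real (Set.Ioi x)

/-- The inverse function of `gaussianQ`, which is a bijection from `ℝ` onto `(0, 1)`. -/
def gaussianQInv : ℝ → ℝ := Function.invFun gaussianQ

namespace FTNSystem

variable (S : FTNSystem)

/-- The Nyquist symbol time `T = (1 + β) / (2W)`. -/
def T : ℝ := (1 + S.β) / (2 * S.W)

/-- The signal-to-noise ratio `ρ = P / (2 W N0)`. -/
def snr : ℝ := S.P / (2 * S.W * S.N0)

/-- The time-bandwidth product `c = 2 W Tp` of the pulse. -/
def c : ℝ := 2 * S.W * S.Tp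

/-- The number `N` of symbols sent within a time-bandwidth product `Ω`. -/
def numSymbols (Ω : ℝ) : ℕ := ⌊(Ω - S.c) / (S.τ * (1 + S.β)) + 1⌋₊

/-- The samples `h_k = ∫ p(t) p(t - kτT) dt` of the pulse autocorrelation. -/
def autocorr (k : ℤ) : ℝ := ∫ t, S.pulse t * S.pulse (t - k * S.τ * S.T)

/-- The `N × N` symmetric Toeplitz channel matrix, with entries `h_{i-j}`. -/
def channelMatrix (N : ℕ) : Matrix (Fin N) (Fin N) ℝ :=
  Matrix.of fun i j => S.autocorr ((i : ℤ) - (j : ℤ))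

theorem autocorr_neg (k : ℤ) : S.autocorr (-k) = S.autocorr k := by
  unfold autocorr
  rw [← integral_sub_right_eq_self _ ((k : ℝ) * S.τ * S.T)]
  refine integral_congr_ae (Filter.Eventually.of_forall fun t => ?_)
  have h : t - (k : ℝ) * S.τ * S.T - ((-k : ℤ) : ℝ) * S.τ * S.T = t := by
    push_cast; ring
  simp only [h]
  exact mul_comm _ _

theorem channelMatrix_isHermitian (N : ℕ) : (S.channelMatrix N).IsHermitian := by
  ext i j
  simp only [channelMatrix, Matrix.conjTranspose_apply, Matrix.of_apply, star_trivial]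
  rw [← S.autocorr_neg, neg_sub]

/-- The eigenvalues `λ_n` of the `N × N` channel matrix, with multiplicity. -/
def eigenvalue (N : ℕ) : Fin N → ℝ := (S.channelMatrix_isHermitian N).eigenvalues

/-- The noise variances `σ_n² = (ρ (Ω / N) λ_n)⁻¹` of the `N`-parallel Gaussian channel model at
time-bandwidth product `Ω`. -/
def noiseVar (Ω : ℝ) (n : Fin (S.numSymbols Ω)) : ℝ :=
  (S.snr * (Ω / S.numSymbols Ω) * S.eigenvalue (S.numSymbols Ω) n)⁻¹

/-- The maximum channel coding rate in bps/Hz of the `N`-parallel Gaussian channel model under the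
constant power constraint, at time-bandwidth product `Ω` and average block error rate `Pe`: the
supremum of `(log₂ M) / Ω` over all codes. -/
def maxCodingRate (Ω Pe : ℝ) : EReal :=
  sSup {r : EReal | ∃ (M : ℕ) (C : ConstantPowerCode (S.numSymbols Ω) M),
    C.bler (S.noiseVar Ω) ≤ Pe ∧ r = ((Real.logb 2 M / Ω : ℝ) : EReal)}

/-- The finite blocklength approximation `C_NA` to the channel capacity. -/
def capacityNA (Ω : ℝ) : ℝ :=
  (1 / Ω) * ∑ n, Real.logb 2 (1 + 1 / S.noiseVar Ω n)

/-- The finite blocklength approximation `V_NA` to the channel dispersion. -/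
def dispersionNA (Ω : ℝ) : ℝ :=
  (1 / Ω) * ∑ n, (1 - 1 / (1 + 1 / S.noiseVar Ω n) ^ 2)

/-- The normal approximation `R_NA` of the maximum channel coding rate, in bps/Hz. -/
def rateNA (Ω Pe : ℝ) : ℝ :=
  S.capacityNA Ω - √(S.dispersionNA Ω / Ω) * Real.logb 2 (Real.exp 1) * gaussianQInv Pe
    + Real.logb 2 Ω / (2 * Ω)

end FTNSystem

end

/-!
The converse compares the law `P` of the output under a codeword with the output law `Q` of a
Gaussian input, `CN(0, 1 + σ_n²)` on the `n`-th channel. The log-likelihood ratio splits into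
independent information densities (`infoDensity`), and because `|x_n|² = 1` their means
`log (1 + 1 / σ_n²)` and variances `V_n = 1 - (1 + 1 / σ_n²)⁻²` do not depend on the codeword
(`integral_infoDensity_sub`, `integral_infoDensity_sub_sq`), while their third moments are bounded
by an absolute constant. A change of measure on the decision regions, whose `Q`-probabilities add up
to one, shows that a code with `M` messages and block error rate `ε` satisfies
`P (ratio ≤ exp t) - exp t / M ≤ ε` as soon as all codewords share the lower tail
(`ConstantPowerCode.le_bler`).

The tail is estimated to the precision `O(Ω ^ (-1/2))` by the lower half of the Berry–Esseen theorem
for independent summands (`gaussianReal_Iic_sub_le_of_sum`), proved by Stein's method: the indicator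
of a half line is replaced by a piecewise linear function of width `γ`, the sum of the third
moments, the solution of Stein's equation is expanded around the sums without one summand, and the
increments of the piecewise linear function are controlled by the Chen–Shao concentration inequality
(`measureReal_sum_mem_Icc_le`). Choosing `t` with `P (ratio ≤ exp t) ≥ ε + Ω ^ (-1/2)` moves the
normal quantile by `O(Ω ^ (-1/2))`, hence `t` by `O(1)`, and yields `log M ≤ t + (log Ω) / 2`.

It remains that `∑ V_n` and `N` are of the exact order `Ω` (`FTNSystem.exists_dispersion_bounds`).
The channel matrix is the Gram matrix of the shifted pulses, so its eigenvalues are positive because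
the shifts of a time-limited pulse are linearly independent, they are bounded because the matrix is
banded, and they add up to `N` because the pulse has unit energy.
-/

/-! ### Stein's equation -/

/-- The solution `f` of Stein's equation `f' w = w * f w + g w` that stays bounded when `g` is
bounded and has mean zero under the standard normal law. -/
noncomputable def steinSol (g : ℝ → ℝ) (w : ℝ) : ℝ :=
  Real.exp (w ^ 2 / 2) * ∫ u in Set.Iic w, g u * Real.exp (-u ^ 2 / 2)

theorem integrable_exp_neg_sq_half : Integrable fun u : ℝ => Real.exp (-u ^ 2 / 2) := by
  refine (integrable_exp_neg_mul_sq (b := 1 / 2) (by norm_num)).congr ?_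
  exact Filter.Eventually.of_forall fun u => by simp only; congr 1; ring

theorem integrable_mul_exp_neg_sq_half {g : ℝ → ℝ} (hg : Continuous g) (hb : ∀ u, |g u| ≤ 1) :
    Integrable fun u => g u * Real.exp (-u ^ 2 / 2) := by
  refine integrable_exp_neg_sq_half.mono' (by fun_prop) (Filter.Eventually.of_forall fun u => ?_)
  rw [Real.norm_eq_abs, abs_mul, Real.abs_exp]
  nlinarith [hb u, Real.exp_pos (-u ^ 2 / 2)]

theorem hasDerivAt_steinSol {g : ℝ → ℝ} (hg : Continuous g) (hb : ∀ u, |g u| ≤ 1) (w : ℝ) :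
    HasDerivAt (steinSol g) (w * steinSol g w + g w) w := by
  have hint := integrable_mul_exp_neg_sq_half hg hb
  have hcont : Continuous fun u => g u * Real.exp (-u ^ 2 / 2) := by fun_prop
  have h1 : HasDerivAt (fun w => ∫ u in Set.Iic w, g u * Real.exp (-u ^ 2 / 2))
      (g w * Real.exp (-w ^ 2 / 2)) w := by
    have h2 : HasDerivAt (fun w => ∫ u in (0 : ℝ)..w, g u * Real.exp (-u ^ 2 / 2))
        (g w * Real.exp (-w ^ 2 / 2)) w :=
      intervalIntegral.integral_hasDerivAt_right (hcont.intervalIntegrable _ _)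
        (hcont.stronglyMeasurableAtFilter _ _) hcont.continuousAt
    refine (h2.const_add
      (∫ u in Set.Iic (0 : ℝ), g u * Real.exp (-u ^ 2 / 2))).congr_of_eventuallyEq
      (Filter.Eventually.of_forall fun v => ?_)
    simp only
    rw [← intervalIntegral.integral_Iic_sub_Iic hint.integrableOn hint.integrableOn]
    ring
  have h3 : HasDerivAt (fun w : ℝ => Real.exp (w ^ 2 / 2)) (Real.exp (w ^ 2 / 2) * w) w := by
    have h := ((hasDerivAt_pow 2 w).div_const 2).exp
    refine h.congr_deriv ?_
    push_cast; ring
  refine (h3.mul h1).congr_deriv ?_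
  have : Real.exp (w ^ 2 / 2) * Real.exp (-w ^ 2 / 2) = 1 := by
    rw [← Real.exp_add, ← Real.exp_zero]; congr 1; ring
  unfold steinSol
  linear_combination (g w) * this

/-- Mean zero of `g` makes the lower and the upper tail integral cancel, so that the bounds for
`w ≤ 0` carry over to `w ≥ 0` by reflection. -/
theorem steinSol_neg {g : ℝ → ℝ} (hg : Continuous g) (hb : ∀ u, |g u| ≤ 1)
    (h0 : ∫ u, g u * Real.exp (-u ^ 2 / 2) = 0) (w : ℝ) :
    steinSol (fun u => g (-u)) (-w) = -steinSol g w := by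
  have hint := integrable_mul_exp_neg_sq_half hg hb
  have h1 : ∫ u in Set.Iic (-w), g (-u) * Real.exp (-u ^ 2 / 2)
      = ∫ u in Set.Ioi w, g u * Real.exp (-u ^ 2 / 2) := by
    have := integral_comp_neg_Iic (-w) (fun u => g u * Real.exp (-u ^ 2 / 2))
    simpa using this
  have h2 := intervalIntegral.integral_Iic_add_Ioi (b := w) hint.integrableOn hint.integrableOn
  rw [h0] at h2
  unfold steinSol
  rw [h1, neg_sq]
  linear_combination Real.exp (w ^ 2 / 2) * h2

theorem abs_steinSol_le_integral {g : ℝ → ℝ} (hb : ∀ u, |g u| ≤ 1) (w : ℝ) :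
    |steinSol g w| ≤ Real.exp (w ^ 2 / 2) * ∫ u in Set.Iic w, Real.exp (-u ^ 2 / 2) := by
  unfold steinSol
  rw [abs_mul, Real.abs_exp]
  gcongr
  rw [← Real.norm_eq_abs]
  refine norm_integral_le_of_norm_le integrable_exp_neg_sq_half.integrableOn
    (Filter.Eventually.of_forall fun u => ?_)
  rw [Real.norm_eq_abs, abs_mul, Real.abs_exp]
  nlinarith [hb u, Real.exp_pos (-u ^ 2 / 2)]

/-- Since `u ^ 2 ≥ w ^ 2 + (u - w) ^ 2` for `u ≤ w ≤ 0`, the normalized tail is at most a full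
Gaussian integral. -/
theorem exp_mul_integral_Iic_le {w : ℝ} (hw : w ≤ 0) :
    Real.exp (w ^ 2 / 2) * ∫ u in Set.Iic w, Real.exp (-u ^ 2 / 2) ≤ 3 := by
  have hs : Integrable fun u : ℝ => Real.exp (-(u - w) ^ 2 / 2) :=
    integrable_exp_neg_sq_half.comp_sub_right w
  calc Real.exp (w ^ 2 / 2) * ∫ u in Set.Iic w, Real.exp (-u ^ 2 / 2)
      = ∫ u in Set.Iic w, Real.exp (w ^ 2 / 2) * Real.exp (-u ^ 2 / 2) :=
        (integral_const_mul _ _).symm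
    _ ≤ ∫ u in Set.Iic w, Real.exp (-(u - w) ^ 2 / 2) := by
        refine setIntegral_mono_on (integrable_exp_neg_sq_half.const_mul _).integrableOn
          hs.integrableOn measurableSet_Iic fun u hu => ?_
        rw [← Real.exp_add]
        apply Real.exp_le_exp.mpr
        have : u ≤ w := hu
        nlinarith
    _ ≤ ∫ u, Real.exp (-(u - w) ^ 2 / 2) :=
        setIntegral_le_integral hs (Filter.Eventually.of_forall fun u => (Real.exp_pos _).le)
    _ = ∫ u, Real.exp (-(1 / 2) * u ^ 2) := by
        rw [integral_sub_right_eq_self (fun u : ℝ => Real.exp (-u ^ 2 / 2)) w]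
        congr 1; ext u; congr 1; ring
    _ = √(Real.pi / (1 / 2)) := integral_gaussian _
    _ ≤ 3 := by
        rw [Real.sqrt_le_left (by norm_num)]
        linarith [Real.pi_le_four]

/-- The Mills ratio bound for the lower tail. -/
theorem abs_mul_exp_mul_integral_Iic_le {w : ℝ} (hw : w ≤ 0) :
    |w| * (Real.exp (w ^ 2 / 2) * ∫ u in Set.Iic w, Real.exp (-u ^ 2 / 2)) ≤ 1 := by
  have hi : Integrable fun u : ℝ => -u * Real.exp (-u ^ 2 / 2) := by
    refine (integrable_mul_exp_neg_mul_sq (b := 1 / 2) (by norm_num)).neg.congr ?_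
    refine Filter.Eventually.of_forall fun u => ?_
    simp only [Pi.neg_apply, neg_mul]
    congr 3; ring
  have hd : ∀ u ∈ Set.Iic w, HasDerivAt (fun u : ℝ => Real.exp (-u ^ 2 / 2))
      (-u * Real.exp (-u ^ 2 / 2)) u := fun u _ => by
    have h := (((hasDerivAt_pow 2 u).fun_neg).div_const 2).exp
    refine h.congr_deriv ?_
    push_cast; ring
  have ht : Filter.Tendsto (fun u : ℝ => Real.exp (-u ^ 2 / 2)) Filter.atBot (nhds 0) := by
    refine Real.tendsto_exp_atBot.comp ?_
    have h1 : Filter.Tendsto (fun u : ℝ => u ^ 2) Filter.atBot Filter.atTop := by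
      simpa [Function.comp_def] using Filter.Tendsto.comp
        (Filter.tendsto_pow_atTop (α := ℝ) (n := 2) two_ne_zero) Filter.tendsto_abs_atBot_atTop
    exact (Filter.tendsto_neg_atTop_atBot.comp h1).atBot_div_const two_pos
  have key := integral_Iic_of_hasDerivAt_of_tendsto' hd hi.integrableOn ht
  have h2 : |w| * ∫ u in Set.Iic w, Real.exp (-u ^ 2 / 2) ≤ Real.exp (-w ^ 2 / 2) := by
    rw [← sub_zero (Real.exp (-w ^ 2 / 2)), ← key, ← integral_const_mul]
    refine setIntegral_mono_on (integrable_exp_neg_sq_half.const_mul _).integrableOn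
      hi.integrableOn measurableSet_Iic fun u hu => ?_
    have : u ≤ w := hu
    rw [abs_of_nonpos hw]
    nlinarith [Real.exp_pos (-u ^ 2 / 2)]
  have h3 : Real.exp (w ^ 2 / 2) * Real.exp (-w ^ 2 / 2) = 1 := by
    rw [← Real.exp_add, ← Real.exp_zero]; congr 1; ring
  calc _ = Real.exp (w ^ 2 / 2) * (|w| * ∫ u in Set.Iic w, Real.exp (-u ^ 2 / 2)) := by ring
    _ ≤ Real.exp (w ^ 2 / 2) * Real.exp (-w ^ 2 / 2) := by gcongr
    _ = 1 := h3

theorem abs_steinSol_le {g : ℝ → ℝ} (hg : Continuous g) (hb : ∀ u, |g u| ≤ 1)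
    (h0 : ∫ u, g u * Real.exp (-u ^ 2 / 2) = 0) (w : ℝ) : |steinSol g w| ≤ 3 := by
  rcases le_total w 0 with hw | hw
  · exact (abs_steinSol_le_integral hb w).trans (exp_mul_integral_Iic_le hw)
  · rw [← abs_neg, ← steinSol_neg hg hb h0]
    exact (abs_steinSol_le_integral (fun u => hb (-u)) (-w)).trans
      (exp_mul_integral_Iic_le (by linarith))

theorem abs_mul_steinSol_le {g : ℝ → ℝ} (hg : Continuous g) (hb : ∀ u, |g u| ≤ 1)
    (h0 : ∫ u, g u * Real.exp (-u ^ 2 / 2) = 0) (w : ℝ) : |w * steinSol g w| ≤ 1 := by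
  rcases le_total w 0 with hw | hw
  · rw [abs_mul]
    exact (mul_le_mul_of_nonneg_left (abs_steinSol_le_integral hb w) (abs_nonneg w)).trans
      (abs_mul_exp_mul_integral_Iic_le hw)
  · rw [abs_mul, ← abs_neg (steinSol g w), ← steinSol_neg hg hb h0, ← abs_neg w]
    exact (mul_le_mul_of_nonneg_left
      (abs_steinSol_le_integral (fun u => hb (-u)) (-w)) (abs_nonneg _)).trans
      (abs_mul_exp_mul_integral_Iic_le (by linarith))

theorem abs_deriv_steinSol_le {g : ℝ → ℝ} (hg : Continuous g) (hb : ∀ u, |g u| ≤ 1)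
    (h0 : ∫ u, g u * Real.exp (-u ^ 2 / 2) = 0) (w : ℝ) : |w * steinSol g w + g w| ≤ 2 :=
  (abs_add_le _ _).trans (by linarith [abs_mul_steinSol_le hg hb h0 w, hb w])

theorem abs_steinSol_sub_le {g : ℝ → ℝ} (hg : Continuous g) (hb : ∀ u, |g u| ≤ 1)
    (h0 : ∫ u, g u * Real.exp (-u ^ 2 / 2) = 0) (x y : ℝ) :
    |steinSol g y - steinSol g x| ≤ 2 * |y - x| :=
  Convex.norm_image_sub_le_of_norm_hasDerivWithin_le (s := Set.univ)
    (fun w _ => (hasDerivAt_steinSol hg hb w).hasDerivWithinAt)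
    (fun w _ => abs_deriv_steinSol_le hg hb h0 w) convex_univ (Set.mem_univ x) (Set.mem_univ y)

/-! ### The concentration inequality -/

/-- The test function of the concentration inequality: linear of slope one around `[a, b]`,
continued by constants at distance `δ` from the interval. -/
noncomputable def ramp (a b δ v : ℝ) : ℝ :=
  max (-((b - a) / 2 + δ)) (min ((b - a) / 2 + δ) (v - (a + b) / 2))

theorem continuous_ramp (a b δ : ℝ) : Continuous (ramp a b δ) := by
  unfold ramp; fun_prop

theorem abs_ramp_le {a b δ : ℝ} (hab : a ≤ b) (hδ : 0 ≤ δ) (v : ℝ) :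
    |ramp a b δ v| ≤ (b - a) / 2 + δ := by
  have : 0 ≤ (b - a) / 2 + δ := by linarith
  exact abs_le.mpr ⟨le_max_left _ _, max_le (by linarith) (min_le_left _ _)⟩

theorem monotone_ramp (a b δ : ℝ) : Monotone (ramp a b δ) := fun x y h => by
  unfold ramp; gcongr

theorem mul_ramp_sub_nonneg (a b δ v x : ℝ) : 0 ≤ x * (ramp a b δ v - ramp a b δ (v - x)) := by
  rcases le_total 0 x with hx | hx
  · exact mul_nonneg hx (sub_nonneg.mpr (monotone_ramp a b δ (by linarith)))
  · exact mul_nonneg_of_nonpos_of_nonpos hx (sub_nonpos.mpr (monotone_ramp a b δ (by linarith)))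

theorem le_mul_ramp_sub {a b δ v : ℝ} (hδ : 0 ≤ δ) (ha : a ≤ v) (hb : v ≤ b) (x : ℝ) :
    |x| * min δ |x| ≤ x * (ramp a b δ v - ramp a b δ (v - x)) := by
  have h1 : ramp a b δ v = v - (a + b) / 2 := by
    unfold ramp
    rw [min_eq_right (by linarith), max_eq_right (by linarith)]
  rw [h1]
  unfold ramp
  rcases le_total 0 x with hx | hx
  · rw [abs_of_nonneg hx]
    refine mul_le_mul_of_nonneg_left ?_ hx
    rw [min_eq_right (by linarith : v - x - (a + b) / 2 ≤ (b - a) / 2 + δ)]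
    rcases max_cases (-((b - a) / 2 + δ)) (v - x - (a + b) / 2) with ⟨h, -⟩ | ⟨h, -⟩ <;> rw [h]
    · exact (min_le_left _ _).trans (by linarith)
    · exact (min_le_right _ _).trans (by linarith)
  · rw [abs_of_nonpos hx, ← neg_mul_neg x]
    refine mul_le_mul_of_nonneg_left ?_ (by linarith)
    rw [max_eq_right (le_min (by linarith) (by linarith))]
    rcases min_cases ((b - a) / 2 + δ) (v - x - (a + b) / 2) with ⟨h, -⟩ | ⟨h, -⟩ <;> rw [h]
    · exact (min_le_left _ _).trans (by linarith)
    · exact (min_le_right _ _).trans (by linarith)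

theorem sq_sub_le_mul_min {δ : ℝ} (hδ : 0 < δ) (x : ℝ) :
    x ^ 2 - |x| ^ 3 / (4 * δ) ≤ |x| * min δ |x| := by
  rw [← sq_abs x]
  have hx := abs_nonneg x
  rcases min_cases δ |x| with ⟨h, -⟩ | ⟨h, -⟩ <;> rw [h]
  · rw [sub_le_iff_le_add]
    have : |x| * δ + |x| ^ 3 / (4 * δ) - |x| ^ 2 = |x| * (2 * δ - |x|) ^ 2 / (4 * δ) := by
      field_simp; ring
    have : 0 ≤ |x| * (2 * δ - |x|) ^ 2 / (4 * δ) := by positivity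
    linarith
  · have : 0 ≤ |x| ^ 3 / (4 * δ) := by positivity
    nlinarith

section IndependentSums

variable {Ω ι : Type*} [MeasurableSpace Ω] {μ : Measure Ω} {ξ : ι → Ω → ℝ}

theorem MeasureTheory.MemLp.integrable_abs_pow_three {X : Ω → ℝ} (h : MemLp X 3 μ) :
    Integrable (fun ω => |X ω| ^ 3) μ := by
  simpa using h.integrable_norm_pow (p := 3) (by norm_num)

/-- A test function of a sum of independent centred variables is correlated with one summand only
through the increment that this summand causes. -/
theorem integral_mul_comp_sum_eq [DecidableEq ι] (hm : ∀ i, Measurable (ξ i)) (hind : iIndepFun ξ μ)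
    (hL : ∀ i, Integrable (ξ i) μ) (h0 : ∀ i, ∫ ω, ξ i ω ∂μ = 0) (s : Finset ι) {i : ι} (hi : i ∈ s)
    {f : ℝ → ℝ} (hf : Measurable f) {B : ℝ} (hB : ∀ v, |f v| ≤ B) :
    ∫ ω, ξ i ω * f (∑ j ∈ s, ξ j ω) ∂μ =
      ∫ ω, ξ i ω * (f (∑ j ∈ s, ξ j ω) - f (∑ j ∈ s, ξ j ω - ξ i ω)) ∂μ := by
  have hsub : ∀ ω, ∑ j ∈ s, ξ j ω - ξ i ω = ∑ j ∈ s.erase i, ξ j ω := fun ω => by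
    rw [← Finset.sum_erase_add _ _ hi]; ring
  have hmS : ∀ t : Finset ι, Measurable fun ω => ∑ j ∈ t, ξ j ω := fun t =>
    Finset.measurable_sum _ fun j _ => hm j
  have hI : ∀ t : Finset ι, Integrable (fun ω => ξ i ω * f (∑ j ∈ t, ξ j ω)) μ := fun t =>
    (hL i).mul_bdd (c := B) (hf.comp (hmS t)).aestronglyMeasurable
      (Filter.Eventually.of_forall fun ω => hB _)
  have hind' : IndepFun (ξ i) (fun ω => f (∑ j ∈ s.erase i, ξ j ω)) μ := by
    have h := (hind.indepFun_finsetSum_of_notMem hm (Finset.notMem_erase i s)).symm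
    have h2 : (∑ j ∈ s.erase i, ξ j) = fun ω => ∑ j ∈ s.erase i, ξ j ω := by
      ext ω; simp
    rw [h2] at h
    exact h.comp measurable_id hf
  simp_rw [hsub, mul_sub]
  rw [integral_sub (hI s) (hI _), hind'.integral_fun_mul_eq_mul_integral
    (hm i).aestronglyMeasurable (hf.comp (hmS _)).aestronglyMeasurable, h0 i, zero_mul, sub_zero]

variable [IsProbabilityMeasure μ]

theorem integral_sq_sum_eq (hind : iIndepFun ξ μ) (hL : ∀ i, MemLp (ξ i) 2 μ)
    (h0 : ∀ i, ∫ ω, ξ i ω ∂μ = 0) (s : Finset ι) :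
    ∫ ω, (∑ i ∈ s, ξ i ω) ^ 2 ∂μ = ∑ i ∈ s, ∫ ω, ξ i ω ^ 2 ∂μ := by
  have h := IndepFun.variance_sum (μ := μ) (X := ξ) (s := s) (fun i _ => hL i)
    (fun i _ j _ hij => hind.indepFun hij)
  have hs : (∑ i ∈ s, ξ i) = fun ω => ∑ i ∈ s, ξ i ω := by ext ω; simp
  have hz : ∫ ω, ∑ i ∈ s, ξ i ω ∂μ = 0 := by
    rw [integral_finsetSum _ fun i _ => (hL i).integrable one_le_two]
    exact Finset.sum_eq_zero fun i _ => h0 i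
  rw [hs, variance_of_integral_eq_zero (memLp_finsetSum s fun i _ => hL i).aemeasurable hz] at h
  rw [h]
  exact Finset.sum_congr rfl fun i _ => variance_of_integral_eq_zero (hL i).aemeasurable (h0 i)

theorem integral_abs_sum_le_one (hind : iIndepFun ξ μ) (hL : ∀ i, MemLp (ξ i) 2 μ)
    (h0 : ∀ i, ∫ ω, ξ i ω ∂μ = 0) (s : Finset ι) (h1 : ∑ i ∈ s, ∫ ω, ξ i ω ^ 2 ∂μ ≤ 1) :
    ∫ ω, |∑ i ∈ s, ξ i ω| ∂μ ≤ 1 := by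
  have hS : MemLp (fun ω => ∑ i ∈ s, ξ i ω) 2 μ := memLp_finsetSum s fun i _ => hL i
  calc ∫ ω, |∑ i ∈ s, ξ i ω| ∂μ ≤ ∫ ω, ((∑ i ∈ s, ξ i ω) ^ 2 + 1) / 2 ∂μ := by
        refine integral_mono (hS.integrable one_le_two).abs
          ((hS.integrable_sq.add (integrable_const _)).div_const 2) fun ω => ?_
        have := sq_nonneg (|∑ i ∈ s, ξ i ω| - 1)
        simp only
        nlinarith [sq_abs (∑ i ∈ s, ξ i ω)]
    _ ≤ 1 := by
        rw [integral_div, integral_add hS.integrable_sq (integrable_const _),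
          integral_sq_sum_eq hind hL h0]
        simp; linarith

/-- The Chen–Shao concentration inequality: an interval of length `ℓ` carries mass at most
`ℓ + 4 γ` when `γ` bounds the sum of the absolute third moments. -/
theorem measureReal_sum_mem_Icc_le (hm : ∀ i, Measurable (ξ i)) (hind : iIndepFun ξ μ)
    (hL : ∀ i, MemLp (ξ i) 3 μ) (h0 : ∀ i, ∫ ω, ξ i ω ∂μ = 0) (s : Finset ι)
    (h1 : ∑ i ∈ s, ∫ ω, ξ i ω ^ 2 ∂μ ≤ 1) (h34 : 3 / 4 ≤ ∑ i ∈ s, ∫ ω, ξ i ω ^ 2 ∂μ)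
    {γ : ℝ} (hγ : 0 < γ) (h3 : ∑ i ∈ s, ∫ ω, |ξ i ω| ^ 3 ∂μ ≤ γ) {a b : ℝ} (hab : a ≤ b) :
    μ.real {ω | ∑ i ∈ s, ξ i ω ∈ Set.Icc a b} ≤ (b - a) + 4 * γ := by
  classical
  have hL2 : ∀ i, MemLp (ξ i) 2 μ := fun i => (hL i).mono_exponent (by norm_num)
  have hL1 : ∀ i, Integrable (ξ i) μ := fun i => (hL2 i).integrable one_le_two
  set V : Ω → ℝ := fun ω => ∑ i ∈ s, ξ i ω with hV
  have hVm : Measurable V := Finset.measurable_sum _ fun j _ => hm j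
  have hVi : Integrable V μ := integrable_finsetSum _ fun i _ => hL1 i
  set A : Set Ω := {ω | V ω ∈ Set.Icc a b} with hA
  have hAm : MeasurableSet A := hVm measurableSet_Icc
  set f := ramp a b γ with hf
  have hfm : Measurable f := (continuous_ramp a b γ).measurable
  have hfb : ∀ v, |f v| ≤ (b - a) / 2 + γ := abs_ramp_le hab hγ.le
  set φ : ℝ → ℝ := fun x => |x| * min γ |x| with hφ
  have hφm : Measurable φ := (by fun_prop : Continuous φ).measurable
  have hφ0 : ∀ x, 0 ≤ φ x := fun x => mul_nonneg (abs_nonneg x) (le_min hγ.le (abs_nonneg x))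
  have hφle : ∀ x, φ x ≤ γ * |x| := fun x => by
    simp only [hφ]; rw [mul_comm]; exact mul_le_mul_of_nonneg_right (min_le_left _ _) (abs_nonneg x)
  have hηL : ∀ i, MemLp (fun ω => φ (ξ i ω)) 2 μ := fun i => by
    refine ((hL2 i).norm.const_mul γ).mono (hφm.comp (hm i)).aestronglyMeasurable
      (Filter.Eventually.of_forall fun ω => ?_)
    rw [Real.norm_of_nonneg (hφ0 _), Real.norm_eq_abs, Real.norm_eq_abs, abs_mul, abs_abs,
      abs_of_pos hγ]
    exact hφle _
  have hηi : ∀ i, Integrable (fun ω => φ (ξ i ω)) μ := fun i => (hηL i).integrable one_le_two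
  set H : Ω → ℝ := fun ω => ∑ i ∈ s, φ (ξ i ω) with hH
  have hHL : MemLp H 2 μ := memLp_finsetSum s fun i _ => hηL i
  have hHi : Integrable H μ := hHL.integrable one_le_two
  -- on `A`, `H` is a lower bound for `∑ ξ i * (f V - f (V - ξ i))`; since
  -- `φ x ≥ x ^ 2 - |x| ^ 3 / (4 γ)`, its mean is at least `3 / 4 - 1 / 4`
  have hmean : 1 / 2 ≤ ∫ ω, H ω ∂μ := by
    rw [hH, integral_finsetSum _ fun i _ => hηi i]
    have : ∀ i ∈ s, ∫ ω, ξ i ω ^ 2 ∂μ - (∫ ω, |ξ i ω| ^ 3 ∂μ) / (4 * γ) ≤ ∫ ω, φ (ξ i ω) ∂μ := by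
      intro i _
      rw [← integral_div, ← integral_sub (hL2 i).integrable_sq
        ((hL i).integrable_abs_pow_three.div_const _)]
      exact integral_mono ((hL2 i).integrable_sq.sub
        ((hL i).integrable_abs_pow_three.div_const _)) (hηi i) fun ω => sq_sub_le_mul_min hγ _
    have h := Finset.sum_le_sum this
    rw [Finset.sum_sub_distrib, ← Finset.sum_div] at h
    have : (∑ i ∈ s, ∫ ω, |ξ i ω| ^ 3 ∂μ) / (4 * γ) ≤ 1 / 4 := by
      rw [div_le_iff₀ (by positivity)]; linarith
    linarith
  -- the summands of `H` are independent and at most `γ |ξ i|`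
  have hvar : Var[H; μ] ≤ γ ^ 2 := by
    have h := IndepFun.variance_sum (μ := μ) (X := fun i ω => φ (ξ i ω)) (s := s)
      (fun i _ => hηL i)
      (fun i _ j _ hij => (hind.indepFun hij).comp hφm hφm)
    have hs : (∑ i ∈ s, fun ω => φ (ξ i ω)) = H := by ext ω; simp [hH]
    rw [hs] at h
    rw [h]
    calc ∑ i ∈ s, Var[fun ω => φ (ξ i ω); μ] ≤ ∑ i ∈ s, γ ^ 2 * ∫ ω, ξ i ω ^ 2 ∂μ := by
          refine Finset.sum_le_sum fun i _ => ?_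
          refine (variance_le_expectation_sq (hηL i).aestronglyMeasurable).trans ?_
          rw [← integral_const_mul]
          refine integral_mono (hηL i).integrable_sq ((hL2 i).integrable_sq.const_mul _) fun ω => ?_
          simp only [Pi.pow_apply]
          rw [← sq_abs (ξ i ω), ← mul_pow]
          exact pow_le_pow_left₀ (hφ0 _) (hφle _) 2
      _ ≤ γ ^ 2 := by
          rw [← Finset.mul_sum]; nlinarith [sq_nonneg γ]
  have hdev : ∫ ω, |H ω - ∫ ω', H ω' ∂μ| ∂μ ≤ γ := by
    have hsq : Integrable (fun ω => (H ω - ∫ ω', H ω' ∂μ) ^ 2) μ :=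
      (hHL.sub (memLp_const _)).integrable_sq
    calc ∫ ω, |H ω - ∫ ω', H ω' ∂μ| ∂μ
        ≤ ∫ ω, ((H ω - ∫ ω', H ω' ∂μ) ^ 2 / γ + γ) / 2 ∂μ := by
          refine integral_mono (hHi.sub (integrable_const _)).abs
            (((hsq.div_const γ).add (integrable_const _)).div_const 2) fun ω => ?_
          simp only
          rw [le_div_iff₀ two_pos, div_add' _ _ _ hγ.ne', le_div_iff₀ hγ]
          nlinarith [sq_nonneg (|H ω - ∫ ω', H ω' ∂μ| - γ), sq_abs (H ω - ∫ ω', H ω' ∂μ)]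
      _ = (Var[H; μ] / γ + γ) / 2 := by
          rw [integral_div, integral_add (hsq.div_const γ) (integrable_const _), integral_div,
            variance_eq_integral hHL.aemeasurable]
          simp
      _ ≤ γ := by
          have : Var[H; μ] / γ ≤ γ := by rw [div_le_iff₀ hγ]; nlinarith
          linarith
  -- `|f| ≤ (b - a) / 2 + γ` and `E |V| ≤ 1` bound the correlation of `V` and `f V` from above
  have hup : ∫ ω, V ω * f (V ω) ∂μ ≤ (b - a) / 2 + γ := by
    have hM : 0 ≤ (b - a) / 2 + γ := by linarith
    calc ∫ ω, V ω * f (V ω) ∂μ ≤ ∫ ω, |V ω| * ((b - a) / 2 + γ) ∂μ := by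
          refine integral_mono (hVi.mul_bdd (c := (b - a) / 2 + γ)
            (hfm.comp hVm).aestronglyMeasurable (Filter.Eventually.of_forall fun ω => hfb _))
            (hVi.abs.mul_const _) fun ω => ?_
          simp only
          refine (le_abs_self _).trans ?_
          rw [abs_mul]
          exact mul_le_mul_of_nonneg_left (hfb _) (abs_nonneg _)
      _ ≤ (b - a) / 2 + γ := by
          rw [integral_mul_const]
          have := integral_abs_sum_le_one hind hL2 h0 s h1
          nlinarith
  -- each increment has the sign of its summand everywhere, and is at least `φ (ξ i)` on `A`
  have hlow : ∫ ω, A.indicator H ω ∂μ ≤ ∫ ω, V ω * f (V ω) ∂μ := by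
    have hI : ∀ i, Integrable (fun ω => ξ i ω * f (V ω)) μ := fun i =>
      (hL1 i).mul_bdd (c := (b - a) / 2 + γ) (hfm.comp hVm).aestronglyMeasurable
        (Filter.Eventually.of_forall fun ω => hfb _)
    have hI' : ∀ i, Integrable (fun ω => ξ i ω * (f (V ω) - f (V ω - ξ i ω))) μ := fun i =>
      (hL1 i).mul_bdd (c := ((b - a) / 2 + γ) + ((b - a) / 2 + γ))
        ((hfm.comp hVm).sub (hfm.comp (hVm.sub (hm i)))).aestronglyMeasurable
        (Filter.Eventually.of_forall fun ω => (abs_sub _ _).trans (add_le_add (hfb _) (hfb _)))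
    have e1 : ∫ ω, V ω * f (V ω) ∂μ = ∑ i ∈ s, ∫ ω, ξ i ω * f (V ω) ∂μ := by
      rw [← integral_finsetSum _ fun i _ => hI i]
      simp_rw [← Finset.sum_mul]; rfl
    have e2 : ∫ ω, A.indicator H ω ∂μ = ∑ i ∈ s, ∫ ω, A.indicator (fun ω => φ (ξ i ω)) ω ∂μ := by
      rw [← integral_finsetSum _ fun i _ => (hηi i).indicator hAm]
      congr 1; ext ω
      by_cases h : ω ∈ A <;> simp [h, hH]
    rw [e1, e2]
    refine Finset.sum_le_sum fun i hi => ?_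
    rw [integral_mul_comp_sum_eq hm hind hL1 h0 s hi hfm hfb]
    refine integral_mono ((hηi i).indicator hAm) (hI' i) fun ω => ?_
    by_cases h : ω ∈ A
    · rw [Set.indicator_of_mem h]
      exact le_mul_ramp_sub hγ.le h.1 h.2 _
    · rw [Set.indicator_of_notMem h]
      exact mul_ramp_sub_nonneg _ _ _ _ _
  have hfin : (∫ ω, H ω ∂μ) * μ.real A - ∫ ω, |H ω - ∫ ω', H ω' ∂μ| ∂μ
      ≤ ∫ ω, A.indicator H ω ∂μ := by
    have : (∫ ω, H ω ∂μ) * μ.real A = ∫ ω, A.indicator (fun _ => ∫ ω, H ω ∂μ) ω ∂μ := by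
      rw [integral_indicator_const _ hAm, smul_eq_mul, mul_comm]
    have hdi : Integrable (fun ω => |H ω - ∫ ω', H ω' ∂μ|) μ := (hHi.sub (integrable_const _)).abs
    rw [this, ← integral_sub ((integrable_const _).indicator hAm) hdi]
    refine integral_mono (((integrable_const _).indicator hAm).sub hdi)
      (hHi.indicator hAm) fun ω => ?_
    by_cases h : ω ∈ A
    · simp only [Set.indicator_of_mem h]
      linarith [neg_abs_le (H ω - ∫ ω', H ω' ∂μ)]
    · simp only [Set.indicator_of_notMem h]
      linarith [abs_nonneg (H ω - ∫ ω', H ω' ∂μ)]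
  have hp : 0 ≤ μ.real A := measureReal_nonneg
  nlinarith

end IndependentSums

/-! ### The Berry–Esseen bound -/

/-- The continuous function that is `1` below `x - γ`, `0` above `x` and linear in between. -/
noncomputable def smoothStep (x γ v : ℝ) : ℝ := max 0 (min 1 ((x - v) / γ))

theorem continuous_smoothStep (x γ : ℝ) : Continuous (smoothStep x γ) := by
  unfold smoothStep; fun_prop

theorem smoothStep_nonneg (x γ v : ℝ) : 0 ≤ smoothStep x γ v := le_max_left _ _

theorem smoothStep_le_one (x γ v : ℝ) : smoothStep x γ v ≤ 1 :=
  max_le zero_le_one (min_le_left _ _)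

theorem smoothStep_eq_one {x γ v : ℝ} (hγ : 0 < γ) (h : v ≤ x - γ) : smoothStep x γ v = 1 := by
  unfold smoothStep
  rw [min_eq_left ((one_le_div hγ).mpr (by linarith)), max_eq_right zero_le_one]

theorem smoothStep_eq_zero {x γ v : ℝ} (hγ : 0 < γ) (h : x ≤ v) : smoothStep x γ v = 0 := by
  unfold smoothStep
  have : (x - v) / γ ≤ 0 := div_nonpos_of_nonpos_of_nonneg (by linarith) hγ.le
  rw [min_eq_right (by linarith), max_eq_left this]

theorem abs_smoothStep_sub_le {x γ : ℝ} (hγ : 0 < γ) (v t : ℝ) :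
    |smoothStep x γ (v + t) - smoothStep x γ v| ≤ |t| / γ := by
  unfold smoothStep
  refine (abs_max_sub_max_le_max _ _ _ _).trans (max_le (by simp; positivity) ?_)
  refine (abs_min_sub_min_le_max _ _ _ _).trans (max_le (by simp; positivity) ?_)
  rw [← sub_div, abs_div, abs_of_pos hγ, show x - (v + t) - (x - v) = -t by ring, abs_neg]

theorem abs_smoothStep_sub_le_one (x γ v t : ℝ) :
    |smoothStep x γ (v + t) - smoothStep x γ v| ≤ 1 := by
  rw [abs_le]
  constructor <;> linarith [smoothStep_nonneg x γ v, smoothStep_le_one x γ v,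
    smoothStep_nonneg x γ (v + t), smoothStep_le_one x γ (v + t)]

theorem smoothStep_sub_eq_zero {x γ v t : ℝ} (hγ : 0 < γ)
    (h : v ∉ Set.Icc (x - γ - |t|) (x + |t|)) : smoothStep x γ (v + t) - smoothStep x γ v = 0 := by
  rw [Set.mem_Icc, not_and_or, not_le, not_le] at h
  have h0 := abs_nonneg t
  rcases h with h | h
  · rw [smoothStep_eq_one hγ (by linarith [le_abs_self t]), smoothStep_eq_one hγ (by linarith),
      sub_self]
  · rw [smoothStep_eq_zero hγ (by linarith [neg_abs_le t]), smoothStep_eq_zero hγ (by linarith),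
      sub_self]

theorem integral_mul_exp_neg_sq_half (g : ℝ → ℝ) :
    ∫ u, g u * Real.exp (-u ^ 2 / 2) = √(2 * Real.pi) * ∫ u, g u ∂gaussianReal 0 1 := by
  rw [integral_gaussianReal_eq_integral_smul one_ne_zero, ← integral_const_mul]
  congr 1; ext u
  simp only [gaussianPDFReal, smul_eq_mul, sub_zero, NNReal.coe_one, mul_one]
  have : √(2 * Real.pi) ≠ 0 := by positivity
  field_simp

theorem integral_sub_mean_mul_exp {h : ℝ → ℝ} (hh : Integrable h (gaussianReal 0 1)) :
    ∫ u, (h u - ∫ v, h v ∂gaussianReal 0 1) * Real.exp (-u ^ 2 / 2) = 0 := by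
  rw [integral_mul_exp_neg_sq_half, integral_sub hh (integrable_const _)]
  simp

section IndependentSums

variable {Ω ι : Type*} [MeasurableSpace Ω] {μ : Measure Ω} [IsProbabilityMeasure μ]

theorem ProbabilityTheory.IndepFun.integral_comp_prod {X Y : Ω → ℝ} (hX : Measurable X)
    (hY : Measurable Y) (hXY : IndepFun X Y μ) {F : ℝ × ℝ → ℝ} (hF : Measurable F)
    (hi : Integrable (fun ω => F (X ω, Y ω)) μ) :
    ∫ ω, F (X ω, Y ω) ∂μ = ∫ ω, ∫ ω', F (X ω, Y ω') ∂μ ∂μ := by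
  have h1 : μ.map (fun ω => (X ω, Y ω)) = (μ.prod μ).map (Prod.map X Y) := by
    rw [(indepFun_iff_map_prod_eq_prod_map_map hX.aemeasurable hY.aemeasurable).mp hXY,
      Measure.map_prod_map _ _ hX hY]
  have hp : Measurable fun ω => (X ω, Y ω) := hX.prodMk hY
  have hp' : Measurable (Prod.map X Y) := hX.prodMap hY
  have h2 := integral_map (μ := μ) hp.aemeasurable (f := F) hF.aestronglyMeasurable
  have hi2 : Integrable (fun p : Ω × Ω => F (Prod.map X Y p)) (μ.prod μ) := by
    have : Integrable F (μ.map fun ω => (X ω, Y ω)) :=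
      (integrable_map_measure hF.aestronglyMeasurable hp.aemeasurable).mpr hi
    rw [h1] at this
    exact (integrable_map_measure hF.aestronglyMeasurable hp'.aemeasurable).mp this
  rw [← h2, h1, integral_map hp'.aemeasurable hF.aestronglyMeasurable, integral_prod _ hi2]
  rfl

theorem integral_sq_mul_integral_abs_le {X : Ω → ℝ} (h : MemLp X 3 μ) :
    (∫ ω, X ω ^ 2 ∂μ) * ∫ ω, |X ω| ∂μ ≤ ∫ ω, |X ω| ^ 3 ∂μ := by
  set m := ∫ ω, |X ω| ∂μ
  have h2 : MemLp X 2 μ := h.mono_exponent (by norm_num)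
  have h1 : Integrable (fun ω => |X ω|) μ := (h2.integrable one_le_two).abs
  have hm : 0 ≤ m := integral_nonneg fun ω => abs_nonneg _
  have key : 0 ≤ ∫ ω, (|X ω| ^ 3 - m * X ω ^ 2 - (m ^ 2 * |X ω| - m ^ 3)) ∂μ := by
    refine integral_nonneg fun ω => ?_
    have : |X ω| ^ 3 - m * X ω ^ 2 - (m ^ 2 * |X ω| - m ^ 3)
        = (|X ω| - m) ^ 2 * (|X ω| + m) := by rw [← sq_abs (X ω)]; ring
    simp only [Pi.zero_apply]
    rw [this]; positivity
  have hA : Integrable (fun ω => |X ω| ^ 3 - m * X ω ^ 2) μ :=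
    h.integrable_abs_pow_three.sub (h2.integrable_sq.const_mul m)
  have hB : Integrable (fun ω => m ^ 2 * |X ω| - m ^ 3) μ :=
    (h1.const_mul _).sub (integrable_const _)
  rw [integral_sub hA hB, integral_sub h.integrable_abs_pow_three
    (h2.integrable_sq.const_mul m), integral_sub (h1.const_mul _) (integrable_const _),
    integral_const_mul, integral_const_mul] at key
  have e : ∫ ω, |X ω| ∂μ = m := rfl
  rw [e] at key
  simp only [integral_const, probReal_univ, one_smul] at key
  nlinarith

/-- Variables of small third moment have small variance. -/
theorem integral_sq_le_of_abs_pow_three {X : Ω → ℝ} (h : MemLp X 3 μ) :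
    ∫ ω, X ω ^ 2 ∂μ ≤ 2 * ∫ ω, |X ω| ^ 3 ∂μ + 1 / 8 := by
  have h2 : MemLp X 2 μ := h.mono_exponent (by norm_num)
  calc ∫ ω, X ω ^ 2 ∂μ ≤ ∫ ω, (2 * |X ω| ^ 3 + 1 / 8) ∂μ := by
        refine integral_mono h2.integrable_sq
          ((h.integrable_abs_pow_three.const_mul 2).add (integrable_const _)) fun ω => ?_
        simp only
        rw [← sq_abs (X ω)]
        have := abs_nonneg (X ω)
        nlinarith [mul_nonneg this (sq_nonneg (|X ω| - 1 / 3)), sq_nonneg (|X ω| - 1 / 3)]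
    _ = _ := by
        rw [integral_add (h.integrable_abs_pow_three.const_mul 2) (integrable_const _),
          integral_const_mul]
        simp

/-- For a variable `V` that charges every interval `[a, b]` with at most `b - a + 4 γ`, the mean of
the derivative `w ↦ w * f w + g w` of the Stein solution `f` of the centred step function `g` moves
by at most `12 |t|` when `V` is shifted by `t`. -/
theorem abs_integral_steinDeriv_shift_le {V : Ω → ℝ} (hVm : Measurable V) (hVi : Integrable V μ)
    (hV1 : ∫ ω, |V ω| ∂μ ≤ 1) {γ : ℝ} (hγ : 0 < γ)
    (hconc : ∀ a b, a ≤ b → μ.real {ω | V ω ∈ Set.Icc a b} ≤ (b - a) + 4 * γ) {x c : ℝ}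
    {g : ℝ → ℝ} (hg : ∀ v, g v = smoothStep x γ v - c) (hb : ∀ u, |g u| ≤ 1)
    (h0 : ∫ u, g u * Real.exp (-u ^ 2 / 2) = 0) (t : ℝ) :
    |∫ ω, ((V ω + t) * steinSol g (V ω + t) + g (V ω + t)) ∂μ
      - ∫ ω, (V ω * steinSol g (V ω) + g (V ω)) ∂μ| ≤ 12 * |t| := by
  have hgc : Continuous g := by
    rw [funext hg]; exact (continuous_smoothStep x γ).sub continuous_const
  have hfc : Continuous (steinSol g) := continuous_iff_continuousAt.mpr fun w =>
    (hasDerivAt_steinSol hgc hb w).continuousAt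
  have hdc : Continuous fun w => w * steinSol g w + g w := by fun_prop
  have hi : ∀ t, Integrable (fun ω => (V ω + t) * steinSol g (V ω + t) + g (V ω + t)) μ := fun t =>
    .of_bound (hdc.measurable.comp (hVm.add_const t)).aestronglyMeasurable 2
      (Filter.Eventually.of_forall fun ω => abs_deriv_steinSol_le hgc hb h0 _)
  have hi0 := hi 0
  simp only [add_zero] at hi0
  rw [← integral_sub (hi t) hi0]
  set A : Set Ω := {ω | V ω ∈ Set.Icc (x - γ - |t|) (x + |t|)} with hA
  have hAm : MeasurableSet A := hVm measurableSet_Icc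
  have ht := abs_nonneg t
  have hPA : μ.real A ≤ 5 * γ + 2 * |t| := by
    have := hconc (x - γ - |t|) (x + |t|) (by linarith)
    linarith
  -- `κ` bounds the increment of the step function, which vanishes off `A`; if `|t| ≤ γ` then
  -- `μ A ≤ 7 γ` and the factor `|t| / γ` suffices, otherwise `μ A ≤ 7 |t|`
  set κ : ℝ := min (|t| / γ) 1 with hκ
  have hκ0 : 0 ≤ κ := le_min (by positivity) zero_le_one
  have hκA : κ * μ.real A ≤ 7 * |t| := by
    refine (mul_le_mul_of_nonneg_left hPA hκ0).trans ?_
    rcases le_total |t| γ with h | h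
    · calc κ * (5 * γ + 2 * |t|) ≤ |t| / γ * (7 * γ) :=
            mul_le_mul (min_le_left _ _) (by linarith) (by positivity) (by positivity)
        _ = 7 * |t| := by field_simp
    · calc κ * (5 * γ + 2 * |t|) ≤ 1 * (7 * |t|) :=
            mul_le_mul (min_le_right _ _) (by linarith) (by positivity) (by positivity)
        _ = 7 * |t| := one_mul _
  have hpt : ∀ ω, |(V ω + t) * steinSol g (V ω + t) + g (V ω + t)
      - (V ω * steinSol g (V ω) + g (V ω))|
      ≤ |V ω| * (2 * |t|) + 3 * |t| + A.indicator (fun _ => κ) ω := by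
    intro ω
    have e : (V ω + t) * steinSol g (V ω + t) + g (V ω + t) - (V ω * steinSol g (V ω) + g (V ω))
        = V ω * (steinSol g (V ω + t) - steinSol g (V ω)) + t * steinSol g (V ω + t)
          + (smoothStep x γ (V ω + t) - smoothStep x γ (V ω)) := by
      rw [hg, hg]; ring
    rw [e]
    refine (abs_add_le _ _).trans (add_le_add ((abs_add_le _ _).trans (add_le_add ?_ ?_)) ?_)
    · rw [abs_mul]
      refine mul_le_mul_of_nonneg_left ?_ (abs_nonneg _)
      simpa using abs_steinSol_sub_le hgc hb h0 (V ω) (V ω + t)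
    · rw [abs_mul, mul_comm 3]
      exact mul_le_mul_of_nonneg_left (abs_steinSol_le hgc hb h0 _) ht
    · by_cases h : ω ∈ A
      · rw [Set.indicator_of_mem h]
        exact le_min (abs_smoothStep_sub_le hγ _ _) (abs_smoothStep_sub_le_one _ _ _ _)
      · rw [Set.indicator_of_notMem h, smoothStep_sub_eq_zero hγ h, abs_zero]
  have hi1 : Integrable (fun ω => |V ω| * (2 * |t|) + 3 * |t|) μ :=
    (hVi.abs.mul_const _).add (integrable_const _)
  have hi2 : Integrable (A.indicator fun _ => κ) μ := (integrable_const _).indicator hAm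
  rw [← Real.norm_eq_abs]
  calc _ ≤ ∫ ω, (|V ω| * (2 * |t|) + 3 * |t| + A.indicator (fun _ => κ) ω) ∂μ :=
        norm_integral_le_of_norm_le (hi1.add hi2) (Filter.Eventually.of_forall hpt)
    _ = (∫ ω, |V ω| ∂μ) * (2 * |t|) + 3 * |t| + μ.real A * κ := by
        rw [integral_add hi1 hi2, integral_add (hVi.abs.mul_const _) (integrable_const _),
          integral_mul_const, integral_indicator_const _ hAm]
        simp
    _ ≤ 12 * |t| := by nlinarith

/-- A first-order Taylor estimate from a derivative that is Lipschitz at one point. -/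
theorem abs_taylor_le_of_abs_deriv_sub_le {Ψ ψ : ℝ → ℝ} (hd : ∀ t, HasDerivAt Ψ (ψ t) t) {L : ℝ}
    (hL : 0 ≤ L) (h : ∀ t, |ψ t - ψ 0| ≤ L * |t|) (t : ℝ) :
    |Ψ t - Ψ 0 - t * ψ 0| ≤ L * t ^ 2 := by
  have hd' : ∀ s ∈ Set.uIcc 0 t, HasDerivWithinAt (fun s => Ψ s - s * ψ 0) (ψ s - ψ 0)
      (Set.uIcc 0 t) s := fun s _ => by
    have := (hd s).fun_sub ((hasDerivAt_id s).mul_const (ψ 0))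
    rw [one_mul] at this
    exact this.hasDerivWithinAt
  have hbd : ∀ s ∈ Set.uIcc 0 t, ‖ψ s - ψ 0‖ ≤ L * |t| := fun s hs => by
    refine (h s).trans (mul_le_mul_of_nonneg_left ?_ hL)
    have := Set.abs_sub_left_of_mem_uIcc hs
    simpa using this
  have := Convex.norm_image_sub_le_of_norm_hasDerivWithin_le hd' hbd (convex_uIcc 0 t)
    Set.left_mem_uIcc Set.right_mem_uIcc
  simp only [Real.norm_eq_abs, zero_mul, sub_zero] at this
  calc |Ψ t - Ψ 0 - t * ψ 0| = |Ψ t - t * ψ 0 - Ψ 0| := by congr 1; ring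
    _ ≤ L * |t| * |t| := this
    _ = L * t ^ 2 := by rw [mul_assoc, abs_mul_abs_self, sq]

end IndependentSums

section IndependentSums

variable {Ω ι : Type*} [MeasurableSpace Ω] {μ : Measure Ω} [IsProbabilityMeasure μ]

theorem hasDerivAt_integral_steinSol_shift {V : Ω → ℝ} (hVm : Measurable V) {g : ℝ → ℝ}
    (hgc : Continuous g) (hb : ∀ u, |g u| ≤ 1) (h0 : ∫ u, g u * Real.exp (-u ^ 2 / 2) = 0) (t : ℝ) :
    HasDerivAt (fun t => ∫ ω, steinSol g (V ω + t) ∂μ)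
      (∫ ω, ((V ω + t) * steinSol g (V ω + t) + g (V ω + t)) ∂μ) t := by
  have hfc : Continuous (steinSol g) := continuous_iff_continuousAt.mpr fun w =>
    (hasDerivAt_steinSol hgc hb w).continuousAt
  have hdc : Continuous fun w => w * steinSol g w + g w := by fun_prop
  have hfm : ∀ t, AEStronglyMeasurable (fun ω => steinSol g (V ω + t)) μ := fun t =>
    (hfc.measurable.comp (hVm.add_const t)).aestronglyMeasurable
  refine (hasDerivAt_integral_of_dominated_loc_of_deriv_le (bound := fun _ => 2)
    (F := fun t ω => steinSol g (V ω + t))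
    (F' := fun t ω => (V ω + t) * steinSol g (V ω + t) + g (V ω + t)) Filter.univ_mem
    (Filter.Eventually.of_forall hfm)
    (.of_bound (hfm t) 3 (Filter.Eventually.of_forall fun ω => abs_steinSol_le hgc hb h0 _))
    (hdc.measurable.comp (hVm.add_const t)).aestronglyMeasurable
    (Filter.Eventually.of_forall fun ω s _ => abs_deriv_steinSol_le hgc hb h0 _)
    (integrable_const _) (Filter.Eventually.of_forall fun ω s _ => ?_)).2
  simpa using (hasDerivAt_steinSol hgc hb (V ω + s)).comp_const_add (V ω) s

/-- The contribution of one summand `X`, independent of the remaining sum `V`, to Stein's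
equation. -/
theorem stein_summand_le {X V : Ω → ℝ} (hX : Measurable X) (hXL : MemLp X 3 μ)
    (hX0 : ∫ ω, X ω ∂μ = 0) (hVm : Measurable V) (hXV : IndepFun X V μ) (hVi : Integrable V μ)
    (hV1 : ∫ ω, |V ω| ∂μ ≤ 1) {γ : ℝ} (hγ : 0 < γ)
    (hconc : ∀ a b, a ≤ b → μ.real {ω | V ω ∈ Set.Icc a b} ≤ (b - a) + 4 * γ) {x c : ℝ}
    {g : ℝ → ℝ} (hg : ∀ v, g v = smoothStep x γ v - c) (hb : ∀ u, |g u| ≤ 1)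
    (h0 : ∫ u, g u * Real.exp (-u ^ 2 / 2) = 0) :
    |(∫ ω, X ω ^ 2 ∂μ) * ∫ ω, ((V ω + X ω) * steinSol g (V ω + X ω) + g (V ω + X ω)) ∂μ
      - ∫ ω, X ω * steinSol g (V ω + X ω) ∂μ| ≤ 24 * ∫ ω, |X ω| ^ 3 ∂μ := by
  have hgc : Continuous g := by
    rw [funext hg]; exact (continuous_smoothStep x γ).sub continuous_const
  have hfc : Continuous (steinSol g) := continuous_iff_continuousAt.mpr fun w =>
    (hasDerivAt_steinSol hgc hb w).continuousAt
  have hdc : Continuous fun w => w * steinSol g w + g w := by fun_prop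
  have hX2 : MemLp X 2 μ := hXL.mono_exponent (by norm_num)
  have hX1 : Integrable X μ := hX2.integrable one_le_two
  set Ψ : ℝ → ℝ := fun t => ∫ ω, steinSol g (V ω + t) ∂μ with hΨ
  set ψ : ℝ → ℝ := fun t => ∫ ω, ((V ω + t) * steinSol g (V ω + t) + g (V ω + t)) ∂μ with hψ
  have hd : ∀ t, HasDerivAt Ψ (ψ t) t := hasDerivAt_integral_steinSol_shift hVm hgc hb h0
  have hψL : ∀ t, |ψ t - ψ 0| ≤ 12 * |t| := fun t => by
    have := abs_integral_steinDeriv_shift_le hVm hVi hV1 hγ hconc hg hb h0 t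
    simpa [hψ] using this
  have hT := abs_taylor_le_of_abs_deriv_sub_le hd (by norm_num) hψL
  have hΨm : Measurable Ψ :=
    (continuous_iff_continuousAt.mpr fun t => (hd t).continuousAt).measurable
  have hψm : Measurable ψ := by
    rw [show ψ = deriv Ψ from funext fun t => (hd t).deriv.symm]
    exact measurable_deriv Ψ
  have hΨb : ∀ t, |Ψ t| ≤ 3 := fun t => by
    have := norm_integral_le_of_norm_le_const (μ := μ) (f := fun ω => steinSol g (V ω + t)) (C := 3)
      (Filter.Eventually.of_forall fun ω => abs_steinSol_le hgc hb h0 _)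
    simpa using this
  have hψb : ∀ t, |ψ t| ≤ 2 := fun t => by
    have := norm_integral_le_of_norm_le_const (μ := μ)
      (f := fun ω => (V ω + t) * steinSol g (V ω + t) + g (V ω + t)) (C := 2)
      (Filter.Eventually.of_forall fun ω => abs_deriv_steinSol_le hgc hb h0 _)
    simpa using this
  have hiψ : Integrable (fun ω => ψ (X ω)) μ :=
    .of_bound (hψm.comp hX).aestronglyMeasurable 2 (Filter.Eventually.of_forall fun ω => hψb _)
  have hiΨ : Integrable (fun ω => X ω * Ψ (X ω)) μ :=
    hX1.mul_bdd (c := 3) (hΨm.comp hX).aestronglyMeasurable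
      (Filter.Eventually.of_forall fun ω => hΨb _)
  have e1 : ∫ ω, X ω * steinSol g (V ω + X ω) ∂μ = ∫ ω, X ω * Ψ (X ω) ∂μ := by
    rw [hXV.integral_comp_prod hX hVm (F := fun p => p.1 * steinSol g (p.2 + p.1))
      (by fun_prop : Continuous _).measurable
      (hX1.mul_bdd (c := 3) (hfc.measurable.comp (hVm.add hX)).aestronglyMeasurable
        (Filter.Eventually.of_forall fun ω => abs_steinSol_le hgc hb h0 _))]
    simp only [integral_const_mul, hΨ]
  have e2 : ∫ ω, ((V ω + X ω) * steinSol g (V ω + X ω) + g (V ω + X ω)) ∂μ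
      = ∫ ω, ψ (X ω) ∂μ :=
    hXV.integral_comp_prod hX hVm
      (F := fun p => (p.2 + p.1) * steinSol g (p.2 + p.1) + g (p.2 + p.1))
      (by fun_prop : Continuous _).measurable
      (.of_bound (hdc.measurable.comp (hVm.add hX)).aestronglyMeasurable 2
        (Filter.Eventually.of_forall fun ω => abs_deriv_steinSol_le hgc hb h0 _))
  have hA : |∫ ω, X ω * Ψ (X ω) ∂μ - (∫ ω, X ω ^ 2 ∂μ) * ψ 0| ≤ 12 * ∫ ω, |X ω| ^ 3 ∂μ := by
    have e : ∫ ω, X ω * Ψ (X ω) ∂μ - (∫ ω, X ω ^ 2 ∂μ) * ψ 0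
        = ∫ ω, (X ω * Ψ (X ω) - X ω * Ψ 0 - X ω ^ 2 * ψ 0) ∂μ := by
      have hs : Integrable (fun ω => X ω * Ψ (X ω) - X ω * Ψ 0) μ := hiΨ.sub (hX1.mul_const _)
      rw [integral_sub hs (hX2.integrable_sq.mul_const _), integral_sub hiΨ (hX1.mul_const _),
        integral_mul_const, integral_mul_const, hX0]
      ring
    rw [e, ← integral_const_mul, ← Real.norm_eq_abs]
    refine norm_integral_le_of_norm_le (hXL.integrable_abs_pow_three.const_mul 12)
      (Filter.Eventually.of_forall fun ω => ?_)
    rw [Real.norm_eq_abs, show X ω * Ψ (X ω) - X ω * Ψ 0 - X ω ^ 2 * ψ 0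
      = X ω * (Ψ (X ω) - Ψ 0 - X ω * ψ 0) by ring, abs_mul]
    refine (mul_le_mul_of_nonneg_left (hT (X ω)) (abs_nonneg _)).trans (le_of_eq ?_)
    rw [← sq_abs]; ring
  have hB : |∫ ω, ψ (X ω) ∂μ - ψ 0| ≤ 12 * ∫ ω, |X ω| ∂μ := by
    have e : ∫ ω, ψ (X ω) ∂μ - ψ 0 = ∫ ω, (ψ (X ω) - ψ 0) ∂μ := by
      rw [integral_sub hiψ (integrable_const _)]; simp
    rw [e, ← integral_const_mul, ← Real.norm_eq_abs]
    exact norm_integral_le_of_norm_le (hX1.abs.const_mul 12)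
      (Filter.Eventually.of_forall fun ω => hψL _)
  have hσ : 0 ≤ ∫ ω, X ω ^ 2 ∂μ := integral_nonneg fun ω => sq_nonneg _
  have hB' : |(∫ ω, X ω ^ 2 ∂μ) * (∫ ω, ψ (X ω) ∂μ - ψ 0)| ≤ 12 * ∫ ω, |X ω| ^ 3 ∂μ := by
    rw [abs_mul, abs_of_nonneg hσ]
    have := integral_sq_mul_integral_abs_le hXL
    nlinarith [mul_le_mul_of_nonneg_left hB hσ]
  rw [e1, e2]
  calc _ = |(∫ ω, X ω ^ 2 ∂μ) * (∫ ω, ψ (X ω) ∂μ - ψ 0)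
        - (∫ ω, X ω * Ψ (X ω) ∂μ - (∫ ω, X ω ^ 2 ∂μ) * ψ 0)| := by congr 1; ring
    _ ≤ _ := (abs_sub _ _).trans (by linarith)

theorem gaussianReal_Ioc_le {a b : ℝ} (hab : a ≤ b) :
    (gaussianReal 0 1).real (Set.Ioc a b) ≤ b - a := by
  rw [measureReal_def, gaussianReal_apply_eq_integral 0 one_ne_zero, ENNReal.toReal_ofReal
    (integral_nonneg fun x => gaussianPDFReal_nonneg _ _ _)]
  have h1 : ∀ x, gaussianPDFReal 0 1 x ≤ 1 := fun x => by
    unfold gaussianPDFReal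
    have h2 : 1 ≤ √(2 * Real.pi * (1 : NNReal)) := by
      rw [Real.one_le_sqrt]; simp; linarith [Real.pi_gt_three]
    refine mul_le_one₀ (inv_le_one_of_one_le₀ h2) (Real.exp_pos _).le (Real.exp_le_one_iff.mpr ?_)
    rw [neg_div]
    exact neg_nonpos.mpr (by positivity)
  calc ∫ x in Set.Ioc a b, gaussianPDFReal 0 1 x ≤ ∫ x in Set.Ioc a b, (1 : ℝ) :=
        setIntegral_mono (integrable_gaussianPDFReal 0 1).integrableOn
          (by simp) h1
    _ = b - a := by simp [hab]

theorem gaussianReal_Iic_add_Ioc {a b : ℝ} (hab : a ≤ b) :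
    (gaussianReal 0 1).real (Set.Iic b) =
      (gaussianReal 0 1).real (Set.Iic a) + (gaussianReal 0 1).real (Set.Ioc a b) := by
  rw [← Set.Iic_union_Ioc_eq_Iic hab, measureReal_union _ measurableSet_Ioc]
  exact Set.disjoint_left.mpr fun x (h : x ≤ a) h' => absurd h'.1 (not_lt.mpr h)

/-- The lower half of the Berry–Esseen theorem, for independent and not necessarily identically
distributed summands. -/
theorem gaussianReal_Iic_sub_le_of_sum [Fintype ι] {ξ : ι → Ω → ℝ} (hm : ∀ i, Measurable (ξ i))
    (hind : iIndepFun ξ μ) (hL : ∀ i, MemLp (ξ i) 3 μ) (h0 : ∀ i, ∫ ω, ξ i ω ∂μ = 0)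
    (h1 : ∑ i, ∫ ω, ξ i ω ^ 2 ∂μ = 1) {γ : ℝ} (hγ : 0 < γ)
    (h3 : ∑ i, ∫ ω, |ξ i ω| ^ 3 ∂μ ≤ γ) (x : ℝ) :
    (gaussianReal 0 1).real (Set.Iic x) - 25 * γ ≤ μ.real {ω | ∑ i, ξ i ω ≤ x} := by
  classical
  -- for `γ ≥ 1 / 25` the left side is not positive; smaller `γ` makes every single variance less
  -- than `1 / 4`, as the concentration inequality for the sums without one summand requires
  rcases le_total (1 / 25) γ with hbig | hsmall
  · have : (gaussianReal 0 1).real (Set.Iic x) ≤ 1 := measureReal_le_one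
    have : 0 ≤ μ.real {ω | ∑ i, ξ i ω ≤ x} := measureReal_nonneg
    linarith
  have hL2 : ∀ i, MemLp (ξ i) 2 μ := fun i => (hL i).mono_exponent (by norm_num)
  have hL1 : ∀ i, Integrable (ξ i) μ := fun i => (hL2 i).integrable one_le_two
  set W : Ω → ℝ := fun ω => ∑ i, ξ i ω with hW
  have hWm : Measurable W := Finset.measurable_sum _ fun j _ => hm j
  set h := smoothStep x γ with hh
  have hhc : Continuous h := continuous_smoothStep x γ
  have hhb : ∀ v, |h v| ≤ 1 := fun v =>
    abs_le.mpr ⟨by linarith [smoothStep_nonneg x γ v], smoothStep_le_one x γ v⟩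
  have hhi : ∀ ν : Measure ℝ, IsFiniteMeasure ν → Integrable h ν := fun ν _ =>
    .of_bound hhc.aestronglyMeasurable 1 (Filter.Eventually.of_forall hhb)
  set c := ∫ v, h v ∂gaussianReal 0 1 with hc
  have hc0 : 0 ≤ c := integral_nonneg fun v => smoothStep_nonneg x γ v
  have hc1 : c ≤ 1 := by
    have := integral_mono (hhi (gaussianReal 0 1) inferInstance) (integrable_const 1)
      fun v => smoothStep_le_one x γ v
    simpa using this
  set g : ℝ → ℝ := fun v => h v - c with hg
  have hgc : Continuous g := hhc.sub continuous_const
  have hgb : ∀ v, |g v| ≤ 1 := fun v => by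
    rw [abs_le]
    constructor <;> simp only [hg] <;>
      linarith [smoothStep_nonneg x γ v, smoothStep_le_one x γ v]
  have hg0 : ∫ u, g u * Real.exp (-u ^ 2 / 2) = 0 :=
    integral_sub_mean_mul_exp (hhi (gaussianReal 0 1) inferInstance)
  have hfc : Continuous (steinSol g) := continuous_iff_continuousAt.mpr fun w =>
    (hasDerivAt_steinSol hgc hgb w).continuousAt
  set D : ℝ := ∫ ω, (W ω * steinSol g (W ω) + g (W ω)) ∂μ with hD
  have hstep : ∀ i, |(∫ ω, ξ i ω ^ 2 ∂μ) * D - ∫ ω, ξ i ω * steinSol g (W ω) ∂μ|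
      ≤ 24 * ∫ ω, |ξ i ω| ^ 3 ∂μ := by
    intro i
    have hsum : ∀ ω, ∑ j ∈ Finset.univ.erase i, ξ j ω + ξ i ω = W ω := fun ω =>
      Finset.sum_erase_add _ _ (Finset.mem_univ i)
    have hVar := Finset.sum_erase_add Finset.univ (fun j => ∫ ω, ξ j ω ^ 2 ∂μ) (Finset.mem_univ i)
    have hThird := Finset.sum_erase_add Finset.univ (fun j => ∫ ω, |ξ j ω| ^ 3 ∂μ)
      (Finset.mem_univ i)
    have hσ0 : 0 ≤ ∫ ω, ξ i ω ^ 2 ∂μ := integral_nonneg fun ω => sq_nonneg _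
    have hs0 : ∀ s : Finset ι, 0 ≤ ∑ j ∈ s, ∫ ω, |ξ j ω| ^ 3 ∂μ := fun s =>
      Finset.sum_nonneg fun j _ => integral_nonneg fun ω => by positivity
    have hi3 : 0 ≤ ∫ ω, |ξ i ω| ^ 3 ∂μ := integral_nonneg fun ω => by positivity
    have hσ := integral_sq_le_of_abs_pow_three (hL i)
    have hs0' := hs0 (Finset.univ.erase i)
    have hindV : IndepFun (ξ i) (fun ω => ∑ j ∈ Finset.univ.erase i, ξ j ω) μ := by
      have h := (hind.indepFun_finsetSum_of_notMem hm (Finset.notMem_erase i Finset.univ)).symm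
      rwa [show (∑ j ∈ Finset.univ.erase i, ξ j)
        = fun ω => ∑ j ∈ Finset.univ.erase i, ξ j ω by ext ω; simp] at h
    have := stein_summand_le (hm i) (hL i) (h0 i)
      (Finset.measurable_sum (Finset.univ.erase i) fun j _ => hm j) hindV
      (integrable_finsetSum _ fun j _ => hL1 j)
      (integral_abs_sum_le_one hind hL2 h0 _ (by linarith)) hγ
      (fun a b hab => measureReal_sum_mem_Icc_le hm hind hL h0 _ (by linarith) (by linarith) hγ
        (by linarith) hab) (g := g) (x := x) (c := c) (fun v => rfl) hgb hg0
    simpa only [hsum] using this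
  have hI : ∀ i, Integrable (fun ω => ξ i ω * steinSol g (W ω)) μ := fun i =>
    (hL1 i).mul_bdd (c := 3) (hfc.measurable.comp hWm).aestronglyMeasurable
      (Filter.Eventually.of_forall fun ω => abs_steinSol_le hgc hgb hg0 _)
  have hWi : Integrable (fun ω => W ω * steinSol g (W ω)) μ := by
    simp only [hW, Finset.sum_mul]
    exact integrable_finsetSum _ fun i _ => hI i
  have hgi : Integrable (fun ω => g (W ω)) μ :=
    .of_bound (hgc.measurable.comp hWm).aestronglyMeasurable 1
      (Filter.Eventually.of_forall fun ω => hgb _)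
  have hhWi : Integrable (fun ω => h (W ω)) μ :=
    .of_bound (hhc.measurable.comp hWm).aestronglyMeasurable 1
      (Filter.Eventually.of_forall fun ω => hhb _)
  have hmain : |∫ ω, g (W ω) ∂μ| ≤ 24 * γ := by
    have e : ∫ ω, g (W ω) ∂μ
        = ∑ i, ((∫ ω, ξ i ω ^ 2 ∂μ) * D - ∫ ω, ξ i ω * steinSol g (W ω) ∂μ) := by
      rw [Finset.sum_sub_distrib, ← Finset.sum_mul, h1, one_mul,
        ← integral_finsetSum _ fun i _ => hI i, hD, integral_add hWi hgi]
      simp only [hW, Finset.sum_mul]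
      ring
    rw [e]
    refine (Finset.abs_sum_le_sum_abs _ _).trans ((Finset.sum_le_sum fun i _ => hstep i).trans ?_)
    rw [← Finset.mul_sum]
    linarith
  have hlower : c - 24 * γ ≤ ∫ ω, h (W ω) ∂μ := by
    have : ∫ ω, g (W ω) ∂μ = ∫ ω, h (W ω) ∂μ - c := by
      simp only [hg]
      rw [integral_sub hhWi (integrable_const _)]; simp
    linarith [neg_abs_le (∫ ω, g (W ω) ∂μ)]
  have hset : MeasurableSet {ω | W ω ≤ x} := measurableSet_le hWm measurable_const
  have hupper : ∫ ω, h (W ω) ∂μ ≤ μ.real {ω | W ω ≤ x} := by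
    rw [← integral_indicator_one hset]
    refine integral_mono hhWi ((integrable_const (1 : ℝ)).indicator hset) fun ω => ?_
    by_cases hω : W ω ≤ x
    · rw [Set.indicator_of_mem (show ω ∈ {ω | W ω ≤ x} from hω)]
      exact smoothStep_le_one x γ _
    · rw [Set.indicator_of_notMem (show ω ∉ {ω | W ω ≤ x} from hω)]
      exact (smoothStep_eq_zero hγ (not_le.mp hω).le).le
  have hclow : (gaussianReal 0 1).real (Set.Iic (x - γ)) ≤ c := by
    rw [← integral_indicator_one measurableSet_Iic]
    refine integral_mono ((integrable_const (1 : ℝ)).indicator measurableSet_Iic)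
      (hhi (gaussianReal 0 1) inferInstance) fun v => ?_
    by_cases hv : v ≤ x - γ
    · rw [Set.indicator_of_mem (show v ∈ Set.Iic (x - γ) from hv)]
      exact (smoothStep_eq_one hγ hv).ge
    · rw [Set.indicator_of_notMem (show v ∉ Set.Iic (x - γ) from hv)]
      exact smoothStep_nonneg x γ v
  have h4 := gaussianReal_Iic_add_Ioc (show x - γ ≤ x by linarith)
  have h5 := gaussianReal_Ioc_le (show x - γ ≤ x by linarith)
  linarith

end IndependentSums

/-! ### Moments of the standard normal law -/

theorem integrable_pow_gaussianReal (n : ℕ) :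
    Integrable (fun x : ℝ => x ^ n) (gaussianReal 0 1) := by
  have h := (memLp_id_gaussianReal (μ := 0) (v := 1) n).integrable_norm_pow'
  refine (integrable_norm_iff (by fun_prop)).mp (h.congr (Filter.Eventually.of_forall fun x => ?_))
  simp

theorem integrable_gaussianPDFReal_mul_pow (n : ℕ) :
    Integrable fun x : ℝ => gaussianPDFReal 0 1 x * x ^ n := by
  have h := integrable_pow_gaussianReal n
  rw [gaussianReal_of_var_ne_zero 0 one_ne_zero, integrable_withDensity_iff_integrable_smul'
    (measurable_gaussianPDF 0 1) (Filter.Eventually.of_forall fun x => gaussianPDF_lt_top)] at h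
  simpa [toReal_gaussianPDF] using h

/-- Integration by parts against the standard normal density. -/
theorem integral_pow_add_two_gaussianReal (n : ℕ) :
    ∫ x, x ^ (n + 2) ∂gaussianReal 0 1 = (n + 1) * ∫ x, x ^ n ∂gaussianReal 0 1 := by
  have hd : ∀ x, HasDerivAt (gaussianPDFReal 0 1) (-(x * gaussianPDFReal 0 1 x)) x := fun x => by
    have h1 := ((((hasDerivAt_pow 2 x).fun_neg).div_const 2).exp).const_mul (√(2 * Real.pi))⁻¹
    have h2 : gaussianPDFReal 0 1
        = fun x : ℝ => (√(2 * Real.pi))⁻¹ * Real.exp (-x ^ 2 / 2) := by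
      ext y; simp [gaussianPDFReal]
    rw [h2]
    refine h1.congr_deriv ?_
    push_cast; ring
  have hu : ∀ x : ℝ, HasDerivAt (fun x : ℝ => x ^ (n + 1)) ((n + 1) * x ^ n) x := fun x => by
    simpa using hasDerivAt_pow (n + 1) x
  have i1 := integrable_gaussianPDFReal_mul_pow (n + 2)
  have i2 := integrable_gaussianPDFReal_mul_pow n
  have i3 := integrable_gaussianPDFReal_mul_pow (n + 1)
  have key := integral_mul_deriv_eq_deriv_mul_of_integrable
    (u := fun x : ℝ => x ^ (n + 1)) (v := gaussianPDFReal 0 1) (u' := fun x => (n + 1) * x ^ n)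
    (v' := fun x => -(x * gaussianPDFReal 0 1 x)) (fun x _ => hu x) (fun x _ => hd x)
    (i1.neg.congr (Filter.Eventually.of_forall fun x => by simp; ring))
    ((i2.const_mul ((n : ℝ) + 1)).congr (Filter.Eventually.of_forall fun x => by simp; ring))
    (i3.congr (Filter.Eventually.of_forall fun x => by simp; ring))
  rw [integral_gaussianReal_eq_integral_smul one_ne_zero,
    integral_gaussianReal_eq_integral_smul one_ne_zero, ← integral_const_mul]
  simp only [smul_eq_mul]
  have e1 : ∫ x, x ^ (n + 1) * -(x * gaussianPDFReal 0 1 x)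
      = -∫ x, gaussianPDFReal 0 1 x * x ^ (n + 2) := by
    rw [← integral_neg]; congr 1; ext x; ring
  have e2 : ∫ x, (n + 1) * x ^ n * gaussianPDFReal 0 1 x
      = ∫ x, (n + 1) * (gaussianPDFReal 0 1 x * x ^ n) := by
    congr 1; ext x; ring
  rw [e1, e2] at key
  linarith

theorem integral_quadratic_gaussianReal (s : ℝ) :
    ∫ a, (1 / 2 - a ^ 2 / 2 + s * a) ∂gaussianReal 0 1 = 0 := by
  have i1 := (integrable_pow_gaussianReal 1)
  have i2 := (integrable_pow_gaussianReal 2)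
  have m1 : ∫ x, x ^ 1 ∂gaussianReal 0 1 = 0 := by simp [integral_id_gaussianReal]
  have m2 : ∫ x, x ^ 2 ∂gaussianReal 0 1 = 1 := by
    have := integral_pow_add_two_gaussianReal 0
    simpa using this
  simp only [pow_one] at i1 m1
  have ha : Integrable (fun a : ℝ => 1 / 2 - a ^ 2 / 2) (gaussianReal 0 1) :=
    (integrable_const _).sub (i2.div_const 2)
  rw [integral_add ha (i1.const_mul s), integral_sub (integrable_const _) (i2.div_const 2),
    integral_const_mul, m1, integral_div, integral_div, m2]
  simp

theorem integral_quadratic_sq_gaussianReal (s : ℝ) :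
    ∫ a, (1 / 2 - a ^ 2 / 2 + s * a) ^ 2 ∂gaussianReal 0 1 = 1 / 2 + s ^ 2 := by
  have i1 := (integrable_pow_gaussianReal 1)
  have i2 := (integrable_pow_gaussianReal 2)
  have i3 := (integrable_pow_gaussianReal 3)
  have i4 := (integrable_pow_gaussianReal 4)
  have m1 : ∫ x, x ^ 1 ∂gaussianReal 0 1 = 0 := by simp [integral_id_gaussianReal]
  have m2 : ∫ x, x ^ 2 ∂gaussianReal 0 1 = 1 := by
    have := integral_pow_add_two_gaussianReal 0
    simpa using this
  have m3 := integral_pow_add_two_gaussianReal 1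
  have m4 := integral_pow_add_two_gaussianReal 2
  rw [m1] at m3
  rw [m2] at m4
  have e : (fun a : ℝ => (1 / 2 - a ^ 2 / 2 + s * a) ^ 2)
      = fun a => 1 / 4 + s * a ^ 1 + (s ^ 2 - 1 / 2) * a ^ 2 + -s * a ^ 3 + 1 / 4 * a ^ 4 := by
    ext a; ring
  have j1 : Integrable (fun a : ℝ => 1 / 4 + s * a ^ 1) (gaussianReal 0 1) :=
    (integrable_const _).add (i1.const_mul s)
  have j2 : Integrable (fun a : ℝ => 1 / 4 + s * a ^ 1 + (s ^ 2 - 1 / 2) * a ^ 2)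
    (gaussianReal 0 1) := j1.add (i2.const_mul _)
  have j3 : Integrable (fun a : ℝ => 1 / 4 + s * a ^ 1 + (s ^ 2 - 1 / 2) * a ^ 2 + -s * a ^ 3)
    (gaussianReal 0 1) := j2.add (i3.const_mul _)
  rw [e, integral_add j3 (i4.const_mul _), integral_add j2 (i3.const_mul _),
    integral_add j1 (i2.const_mul _), integral_add (integrable_const _) (i1.const_mul _)]
  simp only [integral_const_mul]
  norm_num at m3 m4
  rw [m1, m2, m3, m4]
  simp; ring

/-! ### Complex Gaussian laws and the information density -/

instance (x : ℂ) (v : ℝ) : IsProbabilityMeasure (complexGaussian x v) :=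
  Measure.isProbabilityMeasure_map (MeasurableEquiv.measurable _).aemeasurable

instance {N : ℕ} (σ2 : Fin N → ℝ) (x : Fin N → ℂ) : IsProbabilityMeasure (outputLaw σ2 x) := by
  unfold outputLaw; infer_instance

/-- The affine map that sends a pair of standard normal variables to a circularly symmetric complex
Gaussian variable of mean `x` and variance `v`. -/
noncomputable def complexAffine (x : ℂ) (v : ℝ) (p : ℝ × ℝ) : ℂ :=
  ⟨√(v / 2) * p.1 + x.re, √(v / 2) * p.2 + x.im⟩

theorem measurable_complexAffine (x : ℂ) (v : ℝ) : Measurable (complexAffine x v) := by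
  have : complexAffine x v = Complex.measurableEquivRealProd.symm ∘
      fun p : ℝ × ℝ => (√(v / 2) * p.1 + x.re, √(v / 2) * p.2 + x.im) := by
    ext p; rfl
  rw [this]
  exact (MeasurableEquiv.measurable _).comp (by fun_prop)

theorem gaussianReal_map_affine (m : ℝ) {v : ℝ} (hv : 0 ≤ v) :
    (gaussianReal 0 1).map (fun a => √v * a + m) = gaussianReal m v.toNNReal := by
  have : (fun a => √v * a + m) = (fun a => a + m) ∘ fun a => √v * a := rfl
  rw [this, ← Measure.map_map (by fun_prop) (by fun_prop), gaussianReal_map_const_mul,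
    gaussianReal_map_add_const]
  congr 1
  · ring
  · ext; simp [Real.sq_sqrt hv, hv]

theorem map_complexAffine (x : ℂ) {v : ℝ} (hv : 0 ≤ v) :
    ((gaussianReal 0 1).prod (gaussianReal 0 1)).map (complexAffine x v) = complexGaussian x v := by
  have hv2 : 0 ≤ v / 2 := by positivity
  have : complexAffine x v = Complex.measurableEquivRealProd.symm ∘
      Prod.map (fun a => √(v / 2) * a + x.re) (fun a => √(v / 2) * a + x.im) := by
    ext p; rfl
  rw [this, ← Measure.map_map (MeasurableEquiv.measurable _)
    (by fun_prop), ← Measure.map_prod_map _ _ (by fun_prop) (by fun_prop),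
    gaussianReal_map_affine _ hv2, gaussianReal_map_affine _ hv2]
  rfl

/-- The logarithm of the density of `CN(x, v)` with respect to `CN(0, 1 + v)`, the output law of
a Gaussian input of unit power (for `v > 0`). -/
noncomputable def infoDensity (x : ℂ) (v : ℝ) (y : ℂ) : ℝ :=
  Real.log (1 + 1 / v) - ‖y - x‖ ^ 2 / v + ‖y‖ ^ 2 / (1 + v)

theorem continuous_infoDensity (x : ℂ) (v : ℝ) : Continuous (infoDensity x v) := by
  unfold infoDensity; fun_prop

/-- The density of one normal law with respect to a centred one. -/
theorem gaussianReal_eq_withDensity (m : ℝ) {v w : ℝ} (hv : 0 < v) (hw : 0 < w) :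
    gaussianReal m v.toNNReal = (gaussianReal 0 w.toNNReal).withDensity fun y =>
      ENNReal.ofReal
        (Real.exp (Real.log (w / v) / 2 - (y - m) ^ 2 / (2 * v) + y ^ 2 / (2 * w))) := by
  have hv' : v.toNNReal ≠ 0 := by simpa using hv
  have hw' : w.toNNReal ≠ 0 := by simpa using hw
  rw [gaussianReal_of_var_ne_zero _ hv', gaussianReal_of_var_ne_zero _ hw',
    ← withDensity_mul _ (measurable_gaussianPDF _ _) (by fun_prop)]
  congr 1
  ext y
  simp only [Pi.mul_apply, gaussianPDF, gaussianPDFReal, Real.coe_toNNReal _ hv.le,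
    Real.coe_toNNReal _ hw.le, sub_zero]
  rw [← ENNReal.ofReal_mul (by positivity)]
  congr 1
  have h1 : Real.exp (Real.log (w / v) / 2) = √w / √v := by
    rw [← Real.sqrt_div hw.le, ← Real.log_sqrt (by positivity), Real.exp_log (by positivity)]
  rw [sub_eq_add_neg (Real.log (w / v) / 2), Real.exp_add, Real.exp_add, h1,
    Real.sqrt_mul (show 0 ≤ 2 * Real.pi by positivity) v,
    Real.sqrt_mul (show 0 ≤ 2 * Real.pi by positivity) w]
  have h2 : Real.exp (-y ^ 2 / (2 * w)) * Real.exp (y ^ 2 / (2 * w)) = 1 := by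
    rw [← Real.exp_add, ← Real.exp_zero]; congr 1; ring
  have h3 : Real.exp (-(y - m) ^ 2 / (2 * v)) = Real.exp (-((y - m) ^ 2 / (2 * v))) := by
    rw [neg_div]
  rw [h3]
  have a1 : √w ≠ 0 := by positivity
  have a2 : √v ≠ 0 := by positivity
  have a3 : √(2 * Real.pi) ≠ 0 := by positivity
  calc _ = (√(2 * Real.pi) * √v)⁻¹ * Real.exp (-((y - m) ^ 2 / (2 * v))) * 1 := by ring
    _ = _ := by
      rw [← h2]; field_simp

theorem complexGaussian_eq_withDensity (x : ℂ) {v : ℝ} (hv : 0 < v) :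
    complexGaussian x v = (complexGaussian 0 (1 + v)).withDensity fun y =>
      ENNReal.ofReal (Real.exp (infoDensity x v y)) := by
  have hm := (continuous_infoDensity x v).measurable
  unfold complexGaussian
  simp only [Complex.zero_re, Complex.zero_im]
  rw [gaussianReal_eq_withDensity x.re (half_pos hv) (show 0 < (1 + v) / 2 by positivity),
    gaussianReal_eq_withDensity x.im (half_pos hv) (show 0 < (1 + v) / 2 by positivity),
    prod_withDensity (by fun_prop) (by fun_prop)]
  ext s hs
  rw [Measure.map_apply (MeasurableEquiv.measurable _) hs, withDensity_apply _
    (MeasurableEquiv.measurable _ hs), withDensity_apply _ hs, setLIntegral_map hs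
    (by fun_prop) (MeasurableEquiv.measurable _)]
  refine lintegral_congr fun p => ?_
  rw [← ENNReal.ofReal_mul (Real.exp_pos _).le, ← Real.exp_add]
  congr 2
  have h1 : (1 + v) / 2 / (v / 2) = 1 + 1 / v := by field_simp; ring
  have e : Complex.measurableEquivRealProd.symm p = ⟨p.1, p.2⟩ := rfl
  rw [h1, infoDensity, e, Complex.sq_norm, Complex.sq_norm, Complex.normSq_apply,
    Complex.normSq_apply]
  simp only [Complex.sub_re, Complex.sub_im]
  field_simp
  ring

theorem lintegral_pi_prod_eq {ι : Type*} [Fintype ι] {E : ι → Type*} [∀ i, MeasurableSpace (E i)]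
    (ν : ∀ i, Measure (E i)) [∀ i, IsProbabilityMeasure (ν i)] {F : ∀ i, E i → ENNReal}
    (hF : ∀ i, Measurable (F i)) :
    ∫⁻ y, ∏ i, F i (y i) ∂Measure.pi ν = ∏ i, ∫⁻ y, F i y ∂ν i := by
  have h := lintegral_prod_eq_prod_lintegral_of_indepFun (μ := Measure.pi ν) Finset.univ
    (fun i y => F i (y i)) (iIndepFun_pi fun i => (hF i).aemeasurable)
    (fun i => (hF i).comp (measurable_pi_apply i))
  rw [h]
  refine Finset.prod_congr rfl fun i _ => ?_
  have := (measurePreserving_eval ν i).lintegral_comp (hF i)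
  exact this

/-- A product of laws with densities has the product of the densities as density. -/
theorem pi_withDensity {ι : Type*} [Fintype ι] {E : ι → Type*} [∀ i, MeasurableSpace (E i)]
    (ν ν' : ∀ i, Measure (E i)) [∀ i, IsProbabilityMeasure (ν i)]
    [∀ i, IsProbabilityMeasure (ν' i)] {F : ∀ i, E i → ENNReal} (hF : ∀ i, Measurable (F i))
    (h : ∀ i, ν' i = (ν i).withDensity (F i)) :
    Measure.pi ν' = (Measure.pi ν).withDensity fun y => ∏ i, F i (y i) := by
  refine Measure.pi_eq fun s hs => ?_
  rw [withDensity_apply _ (MeasurableSet.univ_pi hs), ← lintegral_indicator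
    (MeasurableSet.univ_pi hs)]
  have e : (Set.univ.pi s).indicator (fun y => ∏ i, F i (y i))
      = fun y => ∏ i, (s i).indicator (F i) (y i) := by
    ext y
    by_cases hy : y ∈ Set.univ.pi s
    · rw [Set.indicator_of_mem hy]
      exact Finset.prod_congr rfl fun i _ => (Set.indicator_of_mem (hy i trivial) _).symm
    · rw [Set.indicator_of_notMem hy]
      simp only [Set.mem_univ_pi, not_forall] at hy
      obtain ⟨i, hi⟩ := hy
      exact (Finset.prod_eq_zero (Finset.mem_univ i) (Set.indicator_of_notMem hi _)).symm
  rw [e, lintegral_pi_prod_eq ν fun i => (hF i).indicator (hs i)]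
  refine Finset.prod_congr rfl fun i _ => ?_
  rw [h i, withDensity_apply _ (hs i), lintegral_indicator (hs i)]

theorem outputLaw_eq_withDensity {N : ℕ} {σ2 : Fin N → ℝ} (hσ : ∀ n, 0 < σ2 n) (x : Fin N → ℂ) :
    outputLaw σ2 x = (outputLaw (fun n => 1 + σ2 n) 0).withDensity fun y =>
      ENNReal.ofReal (Real.exp (∑ n, infoDensity (x n) (σ2 n) (y n))) := by
  have hm : ∀ n, Measurable fun y => ENNReal.ofReal (Real.exp (infoDensity (x n) (σ2 n) y)) :=
    fun n => by
      have := (continuous_infoDensity (x n) (σ2 n)).measurable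
      fun_prop
  unfold outputLaw
  rw [pi_withDensity (fun n => complexGaussian 0 (1 + σ2 n)) _ hm
    fun n => complexGaussian_eq_withDensity (x n) (hσ n)]
  congr 1
  ext y
  rw [Real.exp_sum, ENNReal.ofReal_prod_of_nonneg fun n _ => (Real.exp_pos _).le]

/-! ### The meta-converse -/

/-- The Neyman–Pearson bound behind the converse: a law with density `exp ∘ L` with respect to
`Q` exceeds `exp t * Q D` on `D` only through the event `t < L`. -/
theorem withDensity_exp_real_le {E : Type*} [MeasurableSpace E] {P Q : Measure E}
    [IsProbabilityMeasure P] [IsProbabilityMeasure Q] {L : E → ℝ} (hL : Measurable L)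
    (h : P = Q.withDensity fun y => ENNReal.ofReal (Real.exp (L y))) (t : ℝ) {D : Set E}
    (hD : MeasurableSet D) : P.real {y | L y ≤ t} ≤ P.real Dᶜ + Real.exp t * Q.real D := by
  have hA : MeasurableSet {y | L y ≤ t} := measurableSet_le hL measurable_const
  have h1 : P ({y | L y ≤ t} ∩ D) ≤ ENNReal.ofReal (Real.exp t) * Q D := by
    rw [h, withDensity_apply _ (hA.inter hD)]
    calc ∫⁻ y in {y | L y ≤ t} ∩ D, ENNReal.ofReal (Real.exp (L y)) ∂Q
        ≤ ∫⁻ y in {y | L y ≤ t} ∩ D, ENNReal.ofReal (Real.exp t) ∂Q :=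
          setLIntegral_mono' (hA.inter hD) fun y hy =>
            ENNReal.ofReal_le_ofReal (Real.exp_le_exp.mpr hy.1)
      _ = ENNReal.ofReal (Real.exp t) * Q ({y | L y ≤ t} ∩ D) := by simp
      _ ≤ _ := by gcongr; exact Set.inter_subset_right
  have h2 : P.real ({y | L y ≤ t} ∩ D) ≤ Real.exp t * Q.real D := by
    have := ENNReal.toReal_mono (by finiteness) h1
    rwa [ENNReal.toReal_mul, ENNReal.toReal_ofReal (Real.exp_pos t).le] at this
  have h3 : {y | L y ≤ t} ⊆ Dᶜ ∪ ({y | L y ≤ t} ∩ D) := fun y hy => by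
    by_cases hyD : y ∈ D
    · exact Or.inr ⟨hy, hyD⟩
    · exact Or.inl hyD
  exact (measureReal_mono h3).trans ((measureReal_union_le _ _).trans (by linarith))

/-- The meta-converse for codes whose information density has the same lower tail bound for every
codeword. -/
theorem ConstantPowerCode.le_bler {N M : ℕ} (C : ConstantPowerCode N M) {σ2 : Fin N → ℝ}
    (hσ : ∀ n, 0 < σ2 n) {p t : ℝ} (h : ∀ m, p ≤ (outputLaw σ2 (C.encode m)).real
      {y | ∑ n, infoDensity (C.encode m n) (σ2 n) (y n) ≤ t}) :
    p - Real.exp t / M ≤ C.bler σ2 := by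
  have hM : 0 < (M : ℝ) := by
    have : Nonempty (Fin M) := ⟨C.decode 0⟩
    exact_mod_cast Fin.pos_iff_nonempty.mpr this
  set Q := outputLaw (fun n => 1 + σ2 n) (0 : Fin N → ℂ)
  have hDm : ∀ m, MeasurableSet {y | C.decode y = m} := fun m =>
    C.measurable_decode (measurableSet_singleton m)
  have h1 : ∀ m, p ≤ (outputLaw σ2 (C.encode m)).real {y | C.decode y ≠ m}
      + Real.exp t * Q.real {y | C.decode y = m} := fun m => by
    refine (h m).trans (withDensity_exp_real_le ?_ (outputLaw_eq_withDensity hσ _) t (hDm m))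
    exact Finset.measurable_sum _ fun n _ =>
      (continuous_infoDensity _ _).measurable.comp (measurable_pi_apply n)
  have h2 : ∑ m, Q.real {y | C.decode y = m} = 1 := by
    rw [← measureReal_iUnion_fintype (μ := Q) (f := fun m => {y | C.decode y = m})
      (fun i j hij => Set.disjoint_left.mpr fun y
        (hi : C.decode y = i) (hj : C.decode y = j) => hij (hi.symm.trans hj)) hDm]
    rw [show (⋃ m, {y | C.decode y = m}) = Set.univ by ext y; simp]
    exact probReal_univ
  have h3 := Finset.sum_le_sum fun m (_ : m ∈ Finset.univ) => h1 m
  rw [Finset.sum_add_distrib, ← Finset.mul_sum, h2] at h3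
  simp only [Finset.sum_const, Finset.card_univ, Fintype.card_fin, nsmul_eq_mul, mul_one] at h3
  unfold ConstantPowerCode.bler
  rw [div_mul_eq_mul_div, one_mul, le_div_iff₀ hM, sub_mul, div_mul_cancel₀ _ hM.ne']
  linarith

/-! ### Moments of the information density -/

/-- A polynomial in two standard normal variables that dominates every centred information
density of a unit-power symbol. -/
noncomputable def infoBound (p : ℝ × ℝ) : ℝ := 3 / 2 + 2 * p.1 ^ 2 + (3 / 2 + 2 * p.2 ^ 2)

/-- An absolute constant bounding the third absolute moment of the centred information density. -/
noncomputable def infoThirdMoment : ℝ :=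
  ∫ p, infoBound p ^ 3 ∂(gaussianReal 0 1).prod (gaussianReal 0 1)

theorem infoBound_nonneg (p : ℝ × ℝ) : 0 ≤ infoBound p := by unfold infoBound; positivity

theorem infoThirdMoment_nonneg : 0 ≤ infoThirdMoment :=
  integral_nonneg fun p => pow_nonneg (infoBound_nonneg p) 3

theorem memLp_pow_gaussianReal (n : ℕ) (q : ℕ) :
    MemLp (fun x : ℝ => x ^ n) q (gaussianReal 0 1) := by
  rcases Nat.eq_zero_or_pos q with rfl | hq
  · simpa using (by fun_prop : AEStronglyMeasurable (fun x : ℝ => x ^ n) (gaussianReal 0 1))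
  have h0 : (q : ENNReal) ≠ 0 := by exact_mod_cast hq.ne'
  refine (integrable_norm_rpow_iff (by fun_prop) h0 (by simp)).mp ?_
  refine (integrable_pow_gaussianReal (n * q)).norm.congr (Filter.Eventually.of_forall fun x => ?_)
  simp [pow_mul]

theorem memLp_infoBound :
    MemLp infoBound 3 ((gaussianReal 0 1).prod (gaussianReal 0 1)) := by
  have h2 : MemLp (fun x : ℝ => x ^ 2) 3 (gaussianReal 0 1) := by
    simpa using memLp_pow_gaussianReal 2 3
  have hc : MemLp (fun _ : ℝ => (3 / 2 : ℝ)) 3 (gaussianReal 0 1) := memLp_const _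
  have h : MemLp (fun x : ℝ => 3 / 2 + 2 * x ^ 2) 3 (gaussianReal 0 1) := hc.add (h2.const_mul 2)
  have h4 := (h.comp_fst (gaussianReal 0 1)).add (h.comp_snd (gaussianReal 0 1))
  refine h4.ae_eq (Filter.Eventually.of_forall fun p => ?_)
  simp [infoBound]

/-- The centred information density as a polynomial in standard normal variables. -/
theorem infoDensity_complexAffine {x : ℂ} (hx : ‖x‖ ^ 2 = 1) {v : ℝ} (hv : 0 < v) (p : ℝ × ℝ) :
    infoDensity x v (complexAffine x v p) - Real.log (1 + 1 / v) =
      1 / (1 + v) * ((1 / 2 - p.1 ^ 2 / 2 + √(2 * v) * x.re * p.1)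
        + (1 / 2 - p.2 ^ 2 / 2 + √(2 * v) * x.im * p.2)) := by
  have h1 : √(v / 2) ^ 2 = v / 2 := Real.sq_sqrt (by positivity)
  have h2 : √(2 * v) = 2 * √(v / 2) := by
    rw [show 2 * v = 2 ^ 2 * (v / 2) by ring, Real.sqrt_mul (by positivity),
      Real.sqrt_sq (by norm_num)]
  have h3 : x.re * x.re + x.im * x.im = 1 := by
    rw [← hx, Complex.sq_norm, Complex.normSq_apply]
  have h4 : ‖complexAffine x v p - x‖ ^ 2 = v / 2 * (p.1 ^ 2 + p.2 ^ 2) := by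
    rw [Complex.sq_norm, Complex.normSq_apply]
    simp only [complexAffine, Complex.sub_re, Complex.sub_im]
    linear_combination (p.1 ^ 2 + p.2 ^ 2) * h1
  have h5 : ‖complexAffine x v p‖ ^ 2 =
      v / 2 * (p.1 ^ 2 + p.2 ^ 2) + √(2 * v) * (x.re * p.1 + x.im * p.2) + 1 := by
    rw [Complex.sq_norm, Complex.normSq_apply, h2]
    simp only [complexAffine]
    linear_combination (p.1 ^ 2 + p.2 ^ 2) * h1 + h3
  rw [infoDensity, h4, h5]
  field_simp
  ring

theorem abs_infoDensity_complexAffine_le {x : ℂ} (hx : ‖x‖ ^ 2 = 1) {v : ℝ} (hv : 0 < v)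
    (p : ℝ × ℝ) :
    |infoDensity x v (complexAffine x v p) - Real.log (1 + 1 / v)| ≤ infoBound p := by
  have h3 : x.re * x.re + x.im * x.im = 1 := by
    rw [← hx, Complex.sq_norm, Complex.normSq_apply]
  have hs : √(2 * v) ≤ 1 + v := Real.sqrt_le_iff.mpr ⟨by positivity, by nlinarith [sq_nonneg v]⟩
  have hlin : ∀ r a : ℝ, |r| ≤ 1 → |√(2 * v) * r * a| ≤ (1 + v) * (1 + a ^ 2) / 2 := by
    intro r a hr
    rw [abs_mul, abs_mul, abs_of_nonneg (Real.sqrt_nonneg _)]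
    have h1 : |a| ≤ (1 + a ^ 2) / 2 := by nlinarith [sq_nonneg (|a| - 1), sq_abs a]
    calc √(2 * v) * |r| * |a| ≤ (1 + v) * 1 * ((1 + a ^ 2) / 2) := by gcongr
      _ = _ := by ring
  have l1 := hlin x.re p.1 (abs_le_one_iff_mul_self_le_one.mpr (by nlinarith))
  have l2 := hlin x.im p.2 (abs_le_one_iff_mul_self_le_one.mpr (by nlinarith))
  rw [infoDensity_complexAffine hx hv, abs_mul, abs_of_pos (by positivity), one_div,
    inv_mul_le_iff₀ (by positivity)]
  unfold infoBound
  have hq : ∀ a : ℝ, |1 / 2 - a ^ 2 / 2| ≤ 1 / 2 + a ^ 2 / 2 := fun a => by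
    rw [abs_le]; constructor <;> nlinarith [sq_nonneg a]
  calc _ ≤ (1 / 2 + p.1 ^ 2 / 2 + (1 + v) * (1 + p.1 ^ 2) / 2)
        + (1 / 2 + p.2 ^ 2 / 2 + (1 + v) * (1 + p.2 ^ 2) / 2) :=
        (abs_add_le _ _).trans (add_le_add
          ((abs_add_le _ _).trans (add_le_add (hq _) l1))
          ((abs_add_le _ _).trans (add_le_add (hq _) l2)))
    _ ≤ _ := by nlinarith [mul_nonneg hv.le (sq_nonneg p.1), mul_nonneg hv.le (sq_nonneg p.2),
                  sq_nonneg p.1, sq_nonneg p.2]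

theorem memLp_infoDensity {x : ℂ} (hx : ‖x‖ ^ 2 = 1) {v : ℝ} (hv : 0 < v) :
    MemLp (fun y => infoDensity x v y - Real.log (1 + 1 / v)) 3 (complexGaussian x v) := by
  have hm : Measurable fun y => infoDensity x v y - Real.log (1 + 1 / v) :=
    (continuous_infoDensity x v).measurable.sub_const _
  rw [← map_complexAffine x hv.le, memLp_map_measure_iff hm.aestronglyMeasurable
    (measurable_complexAffine x v).aemeasurable]
  refine memLp_infoBound.mono (hm.comp (measurable_complexAffine x v)).aestronglyMeasurable
    (Filter.Eventually.of_forall fun p => ?_)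
  rw [Real.norm_eq_abs, Real.norm_eq_abs, abs_of_nonneg (infoBound_nonneg p)]
  exact abs_infoDensity_complexAffine_le hx hv p

theorem integral_abs_infoDensity_pow_three_le {x : ℂ} (hx : ‖x‖ ^ 2 = 1) {v : ℝ} (hv : 0 < v) :
    ∫ y, |infoDensity x v y - Real.log (1 + 1 / v)| ^ 3 ∂complexGaussian x v
      ≤ infoThirdMoment := by
  have hm : Measurable fun y => infoDensity x v y - Real.log (1 + 1 / v) :=
    (continuous_infoDensity x v).measurable.sub_const _
  have hL := (memLp_infoDensity hx hv).integrable_abs_pow_three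
  rw [← map_complexAffine x hv.le] at hL ⊢
  have hm3 : AEStronglyMeasurable (fun y => |infoDensity x v y - Real.log (1 + 1 / v)| ^ 3)
      (((gaussianReal 0 1).prod (gaussianReal 0 1)).map (complexAffine x v)) :=
    (hm.norm.pow_const 3).aestronglyMeasurable
  have hL' := (integrable_map_measure hm3 (measurable_complexAffine x v).aemeasurable).mp hL
  rw [integral_map (measurable_complexAffine x v).aemeasurable hm3]
  have hU := memLp_infoBound.integrable_abs_pow_three
  simp only [abs_of_nonneg (infoBound_nonneg _)] at hU
  exact integral_mono hL' hU fun p =>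
    pow_le_pow_left₀ (abs_nonneg _) (abs_infoDensity_complexAffine_le hx hv p) 3

theorem integral_infoDensity_sub {x : ℂ} (hx : ‖x‖ ^ 2 = 1) {v : ℝ} (hv : 0 < v) :
    ∫ y, (infoDensity x v y - Real.log (1 + 1 / v)) ∂complexGaussian x v = 0 := by
  have hm : Measurable fun y => infoDensity x v y - Real.log (1 + 1 / v) :=
    (continuous_infoDensity x v).measurable.sub_const _
  rw [← map_complexAffine x hv.le, integral_map (measurable_complexAffine x v).aemeasurable
    hm.aestronglyMeasurable]
  simp_rw [infoDensity_complexAffine hx hv]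
  have hq : ∀ s : ℝ, Integrable (fun a => 1 / 2 - a ^ 2 / 2 + s * a) (gaussianReal 0 1) := fun s =>
    ((integrable_const _).sub ((integrable_pow_gaussianReal 2).div_const 2)).add
      (((integrable_pow_gaussianReal 1).congr
        (Filter.Eventually.of_forall fun a => by simp)).const_mul s)
  rw [integral_const_mul, integral_add ((hq _).comp_fst _) ((hq _).comp_snd _),
    integral_fun_fst (μ := gaussianReal 0 1) (ν := gaussianReal 0 1)
      (fun a => 1 / 2 - a ^ 2 / 2 + √(2 * v) * x.re * a),
    integral_fun_snd (μ := gaussianReal 0 1) (ν := gaussianReal 0 1)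
      (fun a => 1 / 2 - a ^ 2 / 2 + √(2 * v) * x.im * a),
    integral_quadratic_gaussianReal, integral_quadratic_gaussianReal]
  simp

/-- The variance of the information density of a unit-power symbol is the dispersion of its
channel, whatever the phase of the symbol. -/
theorem integral_infoDensity_sub_sq {x : ℂ} (hx : ‖x‖ ^ 2 = 1) {v : ℝ} (hv : 0 < v) :
    ∫ y, (infoDensity x v y - Real.log (1 + 1 / v)) ^ 2 ∂complexGaussian x v
      = 1 - 1 / (1 + 1 / v) ^ 2 := by
  have hm : Measurable fun y => (infoDensity x v y - Real.log (1 + 1 / v)) ^ 2 :=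
    ((continuous_infoDensity x v).measurable.sub_const _).pow_const 2
  have h3 : x.re * x.re + x.im * x.im = 1 := by
    rw [← hx, Complex.sq_norm, Complex.normSq_apply]
  rw [← map_complexAffine x hv.le, integral_map (measurable_complexAffine x v).aemeasurable
    hm.aestronglyMeasurable]
  simp_rw [infoDensity_complexAffine hx hv, mul_pow]
  have hp1 : MemLp (fun a : ℝ => a) 2 (gaussianReal 0 1) := by
    simpa using memLp_pow_gaussianReal 1 2
  have hp2 : MemLp (fun a : ℝ => a ^ 2 / 2) 2 (gaussianReal 0 1) := by
    simpa [div_eq_inv_mul] using (memLp_pow_gaussianReal 2 2).const_mul (1 / 2)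
  have hq : ∀ s : ℝ, MemLp (fun a => 1 / 2 - a ^ 2 / 2 + s * a) 2 (gaussianReal 0 1) := fun s =>
    ((memLp_const _).sub hp2).add (hp1.const_mul s)
  set A : ℝ → ℝ := fun a => 1 / 2 - a ^ 2 / 2 + √(2 * v) * x.re * a with hA
  set B : ℝ → ℝ := fun a => 1 / 2 - a ^ 2 / 2 + √(2 * v) * x.im * a with hB
  have e : ∫ p, (A p.1 + B p.2) ^ 2 ∂(gaussianReal 0 1).prod (gaussianReal 0 1) = 1 + 2 * v := by
    have hA2 : Integrable (fun p : ℝ × ℝ => A p.1 ^ 2)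
        ((gaussianReal 0 1).prod (gaussianReal 0 1)) :=
      (hq _).integrable_sq.comp_fst _
    have hB2 : Integrable (fun p : ℝ × ℝ => B p.2 ^ 2)
        ((gaussianReal 0 1).prod (gaussianReal 0 1)) :=
      (hq _).integrable_sq.comp_snd _
    have hAB : Integrable (fun p : ℝ × ℝ => 2 * (A p.1 * B p.2))
        ((gaussianReal 0 1).prod (gaussianReal 0 1)) :=
      (((hq _).integrable one_le_two).mul_prod ((hq _).integrable one_le_two)).const_mul 2
    have e1 : (fun p : ℝ × ℝ => (A p.1 + B p.2) ^ 2)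
        = fun p => A p.1 ^ 2 + 2 * (A p.1 * B p.2) + B p.2 ^ 2 := by ext p; ring
    have hs : Integrable (fun p : ℝ × ℝ => A p.1 ^ 2 + 2 * (A p.1 * B p.2))
      ((gaussianReal 0 1).prod (gaussianReal 0 1)) := hA2.add hAB
    rw [e1, integral_add hs hB2, integral_add hA2 hAB, integral_const_mul, integral_prod_mul,
      integral_fun_fst (μ := gaussianReal 0 1) (ν := gaussianReal 0 1) (fun a => A a ^ 2),
      integral_fun_snd (μ := gaussianReal 0 1) (ν := gaussianReal 0 1) (fun a => B a ^ 2),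
      hA, hB, integral_quadratic_gaussianReal, integral_quadratic_sq_gaussianReal,
      integral_quadratic_sq_gaussianReal, mul_pow, mul_pow, Real.sq_sqrt (by positivity)]
    simp
    linear_combination 2 * v * h3
  rw [integral_const_mul, e]
  field_simp
  ring

/-! ### The normal approximation of the information density -/

/-- The lower Berry–Esseen bound for the information density of a constant-power codeword. -/
theorem gaussianReal_Iic_sub_le_outputLaw {N : ℕ} {σ2 : Fin N → ℝ} (hσ : ∀ n, 0 < σ2 n)
    {x : Fin N → ℂ} (hx : ∀ n, ‖x n‖ ^ 2 = 1) {V : ℝ} (hV : 0 < V)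
    (hVsum : ∑ n, (1 - 1 / (1 + 1 / σ2 n) ^ 2) = V) {γ : ℝ} (hγ : 0 < γ)
    (h3 : N * infoThirdMoment ≤ γ * √V ^ 3) (u : ℝ) :
    (gaussianReal 0 1).real (Set.Iic u) - 25 * γ ≤
      (outputLaw σ2 x).real {y | ∑ n, infoDensity (x n) (σ2 n) (y n)
        ≤ ∑ n, Real.log (1 + 1 / σ2 n) + √V * u} := by
  have hs : 0 < √V := Real.sqrt_pos.mpr hV
  set X : Fin N → ℂ → ℝ := fun n y => (infoDensity (x n) (σ2 n) y - Real.log (1 + 1 / σ2 n)) / √V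
    with hX
  have hXm : ∀ n, Measurable (X n) := fun n =>
    ((continuous_infoDensity _ _).measurable.sub_const _).div_const _
  have hLX : ∀ n, MemLp (X n) 3 (complexGaussian (x n) (σ2 n)) := fun n => by
    have := (memLp_infoDensity (hx n) (hσ n)).const_mul (√V)⁻¹
    refine this.ae_eq (Filter.Eventually.of_forall fun y => ?_)
    simp only [hX]; ring
  have hmp : ∀ n, MeasurePreserving (Function.eval n) (outputLaw σ2 x)
      (complexGaussian (x n) (σ2 n)) := fun n => measurePreserving_eval _ n
  have hcomp : ∀ n (F : ℂ → ℝ), Measurable F →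
      ∫ y, F (y n) ∂outputLaw σ2 x = ∫ z, F z ∂complexGaussian (x n) (σ2 n) := fun n F hF => by
    rw [← (hmp n).map_eq, integral_map (measurable_pi_apply n).aemeasurable
      hF.aestronglyMeasurable]
  have key := gaussianReal_Iic_sub_le_of_sum (μ := outputLaw σ2 x) (ξ := fun n y => X n (y n))
    (fun n => (hXm n).comp (measurable_pi_apply n))
    (iIndepFun_pi fun n => (hXm n).aemeasurable)
    (fun n => (hLX n).comp_measurePreserving (hmp n))
    (fun n => by
      rw [hcomp n _ (hXm n)]
      simp only [hX]
      rw [integral_div, integral_infoDensity_sub (hx n) (hσ n), zero_div])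
    (by
      have : ∀ n, ∫ y, X n (y n) ^ 2 ∂outputLaw σ2 x = (1 - 1 / (1 + 1 / σ2 n) ^ 2) / V := by
        intro n
        rw [hcomp n (fun z => X n z ^ 2) ((hXm n).pow_const 2)]
        simp only [hX, div_pow]
        rw [integral_div, integral_infoDensity_sub_sq (hx n) (hσ n), Real.sq_sqrt hV.le]
      simp only [this]
      rw [← Finset.sum_div, hVsum, div_self hV.ne'])
    hγ
    (by
      have : ∀ n, ∫ y, |X n (y n)| ^ 3 ∂outputLaw σ2 x ≤ infoThirdMoment / √V ^ 3 := by
        intro n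
        rw [hcomp n (fun z => |X n z| ^ 3) ((hXm n).norm.pow_const 3)]
        simp only [hX, abs_div, div_pow, abs_of_pos hs]
        rw [integral_div]
        gcongr
        exact integral_abs_infoDensity_pow_three_le (hx n) (hσ n)
      refine (Finset.sum_le_sum fun n _ => this n).trans ?_
      simp only [Finset.sum_const, Finset.card_univ, Fintype.card_fin, nsmul_eq_mul]
      rw [← mul_div_assoc, div_le_iff₀ (by positivity)]
      exact h3) u
  refine key.trans (le_of_eq ?_)
  congr 1
  ext y
  simp only [Set.mem_ofPred_eq, hX]
  rw [← Finset.sum_div, div_le_iff₀ hs, Finset.sum_sub_distrib, sub_le_iff_le_add', mul_comm u]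

/-- A finite-blocklength converse: at block error rate `ε`, the number of messages is at most the
threshold of the information density divided by the excess `η` of its tail over `ε`. -/
theorem ConstantPowerCode.log_card_le_of_bler_le {N M : ℕ} (C : ConstantPowerCode N M)
    {σ2 : Fin N → ℝ} (hσ : ∀ n, 0 < σ2 n) {V : ℝ} (hV : 0 < V)
    (hVsum : ∑ n, (1 - 1 / (1 + 1 / σ2 n) ^ 2) = V) {γ : ℝ} (hγ : 0 < γ)
    (h3 : N * infoThirdMoment ≤ γ * √V ^ 3) {ε η u : ℝ} (hη : 0 < η)
    (hu : ε + η + 25 * γ ≤ (gaussianReal 0 1).real (Set.Iic u)) (hε : C.bler σ2 ≤ ε) :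
    Real.log M ≤ ∑ n, Real.log (1 + 1 / σ2 n) + √V * u - Real.log η := by
  have hM : 0 < (M : ℝ) := by
    have : Nonempty (Fin M) := ⟨C.decode 0⟩
    exact_mod_cast Fin.pos_iff_nonempty.mpr this
  set t := ∑ n, Real.log (1 + 1 / σ2 n) + √V * u with ht
  have h := C.le_bler hσ (t := t) fun m =>
    gaussianReal_Iic_sub_le_outputLaw hσ (C.constant_power m) hV hVsum hγ h3 u
  have h2 : η ≤ Real.exp t / M := by linarith
  rw [le_div_iff₀ hM] at h2
  have h4 := Real.log_le_log (by positivity) h2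
  rw [Real.log_exp, Real.log_mul hη.ne' hM.ne'] at h4
  linarith

/-! ### Eigenvalues of the channel matrix -/

theorem ae_shift {P : ℝ → Prop} (h : ∀ᵐ t : ℝ, P t) (c : ℝ) : ∀ᵐ t : ℝ, P (t - c) :=
  (measurePreserving_sub_right volume c).quasiMeasurePreserving.ae h

namespace FTNSystem

variable (S : FTNSystem)

/-- The spacing `τ T` of the transmitted pulses. -/
noncomputable def spacing : ℝ := S.τ * S.T

theorem spacing_pos : 0 < S.spacing := by
  have := S.τ_pos; have := S.β_nonneg; have := S.W_pos
  unfold spacing T; positivity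

theorem memLp_pulse_shift (c : ℝ) : MemLp (fun t => S.pulse (t - c)) 2 volume :=
  S.pulse_memLp.comp_measurePreserving (measurePreserving_sub_right volume c)

theorem integral_pulse_shift_mul (i j : ℤ) :
    ∫ t, S.pulse (t - i * S.spacing) * S.pulse (t - j * S.spacing) = S.autocorr (i - j) := by
  rw [autocorr, ← integral_sub_right_eq_self
    (fun t => S.pulse t * S.pulse (t - ((i - j : ℤ) : ℝ) * S.τ * S.T)) ((j : ℝ) * S.spacing)]
  congr 1; ext t
  rw [mul_comm]
  congr 2
  unfold spacing; push_cast; ring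

theorem integral_pulse_shift_sq (c : ℝ) : ∫ t, S.pulse (t - c) ^ 2 = 1 := by
  rw [integral_sub_right_eq_self (fun t => S.pulse t ^ 2) c, S.pulse_energy]

theorem autocorr_zero : S.autocorr 0 = 1 := by
  rw [← S.pulse_energy, autocorr]
  congr 1; ext t; simp [sq]

theorem abs_autocorr_le_one (k : ℤ) : |S.autocorr k| ≤ 1 := by
  have h0 := S.memLp_pulse_shift 0
  have h1 := S.memLp_pulse_shift (k * S.τ * S.T)
  simp only [sub_zero] at h0
  unfold autocorr
  rw [← Real.norm_eq_abs]
  calc _ ≤ ∫ t, (S.pulse t ^ 2 + S.pulse (t - k * S.τ * S.T) ^ 2) / 2 := by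
        refine norm_integral_le_of_norm_le ((h0.integrable_sq.add h1.integrable_sq).div_const 2)
          (Filter.Eventually.of_forall fun t => ?_)
        rw [Real.norm_eq_abs, abs_le]
        constructor
        · nlinarith [sq_nonneg (S.pulse t + S.pulse (t - k * S.τ * S.T))]
        · nlinarith [sq_nonneg (S.pulse t - S.pulse (t - k * S.τ * S.T))]
    _ = 1 := by
        rw [integral_div, integral_add h0.integrable_sq h1.integrable_sq, S.pulse_energy,
          S.integral_pulse_shift_sq]
        norm_num

theorem autocorr_eq_zero {k : ℤ} (hk : S.Tp < |(k : ℝ)| * S.spacing) : S.autocorr k = 0 := by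
  obtain ⟨a, ha⟩ := S.pulse_timeLimited
  unfold autocorr
  refine integral_eq_zero_of_ae (Filter.Eventually.of_forall fun t => ?_)
  by_contra h
  simp only [Pi.zero_apply, mul_eq_zero, not_or] at h
  have h1 : t ∈ Set.Icc a (a + S.Tp) := by_contra fun hn => h.1 (ha t hn)
  have h2 : t - k * S.τ * S.T ∈ Set.Icc a (a + S.Tp) := by_contra fun hn => h.2 (ha _ hn)
  have h3 : |(k : ℝ) * S.spacing| ≤ S.Tp := by
    have e : (k : ℝ) * S.spacing = k * S.τ * S.T := by unfold spacing; ring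
    rw [e, abs_le]
    constructor <;> linarith [h1.1, h1.2, h2.1, h2.2]
  rw [abs_mul, abs_of_pos S.spacing_pos] at h3
  linarith

/-- The shifts of a time-limited pulse are linearly independent: in a vanishing combination the
leftmost pulse would vanish on its first `spacing` units of time, then on the next ones, and so on
up to the end of its support. -/
theorem eq_zero_of_sum_pulse_shift {N : ℕ} {x : Fin N → ℝ}
    (h : ∀ᵐ t : ℝ, ∑ i : Fin N, x i * S.pulse (t - (i : ℕ) * S.spacing) = 0) : x = 0 := by
  by_contra hx
  have hδ := S.spacing_pos
  obtain ⟨j, hj⟩ := Function.ne_iff.mp hx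
  classical
  obtain ⟨i₀, hi₀, hmin⟩ := Finset.exists_min_image
    (Finset.univ.filter fun i => x i ≠ 0) (fun i => i) ⟨j, by simpa using hj⟩
  simp only [Finset.mem_filter, Finset.mem_univ, true_and] at hi₀ hmin
  have hstep : ∀ a : ℝ, (∀ᵐ t : ℝ, t < a → S.pulse t = 0) →
      ∀ᵐ t : ℝ, t < a + S.spacing → S.pulse t = 0 := by
    intro a ha
    have hall : ∀ᵐ t : ℝ, ∀ i : Fin N, t - (i : ℕ) * S.spacing < a →
        S.pulse (t - (i : ℕ) * S.spacing) = 0 :=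
      ae_all_iff.mpr fun i => ae_shift ha ((i : ℕ) * S.spacing)
    have h1 : ∀ᵐ t : ℝ, t - (i₀ : ℕ) * S.spacing < a + S.spacing →
        S.pulse (t - (i₀ : ℕ) * S.spacing) = 0 := by
      filter_upwards [h, hall] with t ht hta hlt
      rw [Finset.sum_eq_single i₀] at ht
      · exact (mul_eq_zero.mp ht).resolve_left hi₀
      · intro i _ hi
        by_cases hxi : x i = 0
        · rw [hxi, zero_mul]
        · have hlt' : i₀ < i := lt_of_le_of_ne (hmin i hxi) (Ne.symm hi)
          have hle : ((i₀ : ℕ) : ℝ) + 1 ≤ (i : ℕ) := by exact_mod_cast hlt'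
          rw [hta i (by nlinarith), mul_zero]
      · exact fun hn => absurd (Finset.mem_univ _) hn
    have h2 := ae_shift h1 (-((i₀ : ℕ) * S.spacing))
    simpa using h2
  obtain ⟨a, ha⟩ := S.pulse_timeLimited
  -- the set where the pulse is known to vanish grows by one spacing at a time
  have hk : ∀ k : ℕ, ∀ᵐ t : ℝ, t < a + k * S.spacing → S.pulse t = 0 := by
    intro k
    induction k with
    | zero =>
      refine Filter.Eventually.of_forall fun t ht => ha t fun hmem => ?_
      simp at ht
      linarith [hmem.1]
    | succ k ih =>
      have := hstep _ ih
      refine this.mono fun t ht hlt => ht (hlt.trans_eq ?_)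
      push_cast; ring
  obtain ⟨k, hkk⟩ := exists_nat_gt (S.Tp / S.spacing)
  rw [div_lt_iff₀ hδ] at hkk
  have hz : ∀ᵐ t : ℝ, S.pulse t ^ 2 = 0 := by
    filter_upwards [hk k] with t ht
    by_cases hlt : t < a + k * S.spacing
    · rw [ht hlt]; norm_num
    · rw [ha t fun hmem => hlt (by linarith [hmem.2])]; norm_num
  have := S.pulse_energy
  rw [integral_eq_zero_of_ae hz] at this
  exact zero_ne_one this

/-- The quadratic form of the channel matrix is the energy of the transmitted waveform. -/
theorem dotProduct_channelMatrix_mulVec {N : ℕ} (x : Fin N → ℝ) :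
    x ⬝ᵥ (S.channelMatrix N).mulVec x =
      ∫ t, (∑ i : Fin N, x i * S.pulse (t - (i : ℕ) * S.spacing)) ^ 2 := by
  have hint : ∀ i j : Fin N, Integrable fun t => x i * S.pulse (t - (i : ℕ) * S.spacing) *
      (x j * S.pulse (t - (j : ℕ) * S.spacing)) := fun i j =>
    ((S.memLp_pulse_shift _).const_mul (x i)).integrable_mul
      ((S.memLp_pulse_shift _).const_mul (x j))
  simp_rw [sq, Finset.sum_mul_sum]
  rw [integral_finsetSum _ fun i _ => integrable_finsetSum _ fun j _ => hint i j]
  simp only [dotProduct, Matrix.mulVec, Finset.mul_sum]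
  refine Finset.sum_congr rfl fun i _ => ?_
  rw [integral_finsetSum _ fun j _ => hint i j]
  refine Finset.sum_congr rfl fun j _ => ?_
  have := S.integral_pulse_shift_mul (i : ℕ) (j : ℕ)
  simp only [Int.cast_natCast] at this
  rw [channelMatrix, Matrix.of_apply, ← this, ← integral_mul_const, ← integral_const_mul]
  congr 1; ext t; ring

/-- Positive definiteness matters: an eigenvalue `0` would give the noise variance `0⁻¹ = 0`. -/
theorem posDef_channelMatrix (N : ℕ) : (S.channelMatrix N).PosDef := by
  refine Matrix.PosDef.of_dotProduct_mulVec_pos (S.channelMatrix_isHermitian N) fun x hx => ?_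
  rw [star_trivial, dotProduct_channelMatrix_mulVec]
  refine lt_of_le_of_ne (integral_nonneg fun t => sq_nonneg _) fun h0 => hx ?_
  have hL : MemLp (fun t => ∑ i : Fin N, x i * S.pulse (t - (i : ℕ) * S.spacing)) 2 volume :=
    memLp_finsetSum _ fun i _ => (S.memLp_pulse_shift _).const_mul (x i)
  have := (integral_eq_zero_iff_of_nonneg (fun t => sq_nonneg _) hL.integrable_sq).mp h0.symm
  exact S.eq_zero_of_sum_pulse_shift (this.mono fun t ht => by simpa using ht)

theorem eigenvalue_pos (N : ℕ) (n : Fin N) : 0 < S.eigenvalue N n :=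
  (S.posDef_channelMatrix N).eigenvalues_pos n

theorem sum_eigenvalue (N : ℕ) : ∑ n, S.eigenvalue N n = N := by
  have := (S.channelMatrix_isHermitian N).trace_eq_sum_eigenvalues
  simp only [RCLike.ofReal_real_eq_id, id] at this
  unfold eigenvalue
  rw [← this]
  simp [Matrix.trace, channelMatrix, autocorr_zero]

/-- The eigenvalues are bounded uniformly in `N`, by Gershgorin's theorem and because the channel
matrix is banded. -/
theorem eigenvalue_le (N : ℕ) (n : Fin N) :
    S.eigenvalue N n ≤ 2 * ⌊S.Tp / S.spacing⌋₊ + 1 := by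
  set m := ⌊S.Tp / S.spacing⌋₊ with hm
  have hδ := S.spacing_pos
  have hev : Module.End.HasEigenvalue (Matrix.toLin' (S.channelMatrix N)) (S.eigenvalue N n) := by
    rw [Module.End.hasEigenvalue_iff_mem_spectrum, Matrix.spectrum_toLin']
    exact (S.channelMatrix_isHermitian N).eigenvalues_mem_spectrum_real n
  obtain ⟨k, hk⟩ := eigenvalue_mem_ball hev
  rw [Metric.mem_closedBall, Real.dist_eq] at hk
  have h1 : S.eigenvalue N n ≤ ∑ j, |S.channelMatrix N k j| := by
    rw [← Finset.add_sum_erase _ _ (Finset.mem_univ k)]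
    simp only [Real.norm_eq_abs] at hk
    linarith [le_abs_self (S.eigenvalue N n - S.channelMatrix N k k),
      le_abs_self (S.channelMatrix N k k)]
  have h2 : ∀ j, |S.channelMatrix N k j| ≤
      if ((j : ℕ) : ℤ) ∈ Finset.Icc ((k : ℕ) - m : ℤ) ((k : ℕ) + m) then 1 else 0 := by
    intro j
    rw [channelMatrix, Matrix.of_apply]
    split_ifs with hj
    · exact S.abs_autocorr_le_one _
    · rw [S.autocorr_eq_zero, abs_zero]
      rw [← div_lt_iff₀ hδ]
      have h3 : (m : ℤ) + 1 ≤ |((k : ℕ) : ℤ) - (j : ℕ)| := by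
        rw [Finset.mem_Icc] at hj
        rcases abs_cases (((k : ℕ) : ℤ) - (j : ℕ)) with ⟨h, h'⟩ | ⟨h, h'⟩ <;> rw [h] <;> omega
      calc S.Tp / S.spacing < m + 1 := Nat.lt_floor_add_one _
        _ ≤ _ := by exact_mod_cast h3
  calc S.eigenvalue N n ≤ ∑ j : Fin N, if ((j : ℕ) : ℤ) ∈
        Finset.Icc ((k : ℕ) - m : ℤ) ((k : ℕ) + m) then (1 : ℝ) else 0 :=
        h1.trans (Finset.sum_le_sum fun j _ => h2 j)
    _ = ((Finset.univ.filter fun j : Fin N => ((j : ℕ) : ℤ) ∈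
        Finset.Icc ((k : ℕ) - m : ℤ) ((k : ℕ) + m)).card : ℝ) := by
        rw [Finset.sum_boole]
    _ ≤ ((Finset.Icc ((k : ℕ) - m : ℤ) ((k : ℕ) + m)).card : ℝ) := by
        exact_mod_cast Finset.card_le_card_of_injOn (fun j : Fin N => ((j : ℕ) : ℤ))
          (fun j hj => (Finset.mem_filter.mp hj).2)
          (fun i _ j _ hij => by simpa [Fin.ext_iff] using hij)
    _ = 2 * m + 1 := by
        rw [Int.card_Icc, show ((k : ℕ) + m + 1 - ((k : ℕ) - m) : ℤ) = ((2 * m + 1 : ℕ) : ℤ) by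
          push_cast; ring, Int.toNat_natCast]
        push_cast; ring

end FTNSystem

/-! ### The Gaussian `Q`-function -/

theorem le_gaussianReal_Ioc {a b r : ℝ} (hab : a ≤ b) (ha : -r ≤ a) (hb : b ≤ r) :
    gaussianPDFReal 0 1 r * (b - a) ≤ (gaussianReal 0 1).real (Set.Ioc a b) := by
  rw [measureReal_def, gaussianReal_apply_eq_integral 0 one_ne_zero, ENNReal.toReal_ofReal
    (integral_nonneg fun x => gaussianPDFReal_nonneg _ _ _)]
  calc gaussianPDFReal 0 1 r * (b - a) = ∫ x in Set.Ioc a b, gaussianPDFReal 0 1 r := by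
        simp [hab, mul_comm]
    _ ≤ ∫ x in Set.Ioc a b, gaussianPDFReal 0 1 x := by
        refine setIntegral_mono_on (by simp)
          (integrable_gaussianPDFReal 0 1).integrableOn measurableSet_Ioc fun x hx => ?_
        unfold gaussianPDFReal
        gcongr ?_ * Real.exp ?_
        have : (x - 0) ^ 2 ≤ (r - 0) ^ 2 := by nlinarith [hx.1, hx.2]
        gcongr

theorem gaussianQ_eq_Iic_neg (x : ℝ) : gaussianQ x = (gaussianReal 0 1).real (Set.Iic (-x)) := by
  have h := gaussianReal_map_neg (μ := 0) (v := 1)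
  rw [neg_zero] at h
  unfold gaussianQ
  rw [measureReal_def, measureReal_def]
  conv_rhs => rw [← h, Measure.map_apply measurable_neg measurableSet_Iic]
  have := nullSingletonClass_gaussianReal (μ := 0) (v := 1) one_ne_zero
  rw [show (fun y : ℝ => -y) ⁻¹' Set.Iic (-x) = Set.Ici x by ext y; simp,
    measure_congr Ioi_ae_eq_Ici]

theorem strictMono_gaussianReal_Iic :
    StrictMono fun x : ℝ => (gaussianReal 0 1).real (Set.Iic x) := fun a b hab => by
  have h1 := gaussianReal_Iic_add_Ioc hab.le
  have h2 := le_gaussianReal_Ioc hab.le (r := |a| + |b|)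
    (by linarith [neg_abs_le a, abs_nonneg b]) (by linarith [le_abs_self b, abs_nonneg a])
  have h3 := mul_pos (gaussianPDFReal_pos 0 1 (|a| + |b|) one_ne_zero) (sub_pos.mpr hab)
  simp only
  linarith

theorem continuous_gaussianReal_Iic :
    Continuous fun x : ℝ => (gaussianReal 0 1).real (Set.Iic x) := by
  refine LipschitzWith.continuous (K := 1) (LipschitzWith.of_dist_le_mul fun a b => ?_)
  have key : ∀ a b : ℝ, a ≤ b → |(gaussianReal 0 1).real (Set.Iic b)
      - (gaussianReal 0 1).real (Set.Iic a)| ≤ |b - a| := fun a b hab => by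
    rw [gaussianReal_Iic_add_Ioc hab, add_sub_cancel_left, abs_of_nonneg measureReal_nonneg,
      abs_of_nonneg (sub_nonneg.mpr hab)]
    exact gaussianReal_Ioc_le hab
  rw [NNReal.coe_one, one_mul, Real.dist_eq, Real.dist_eq]
  rcases le_total a b with h | h
  · rw [abs_sub_comm, abs_sub_comm a]; exact key a b h
  · exact key b a h

theorem gaussianQ_injective : Function.Injective gaussianQ := fun x y h => by
  rw [gaussianQ_eq_Iic_neg, gaussianQ_eq_Iic_neg] at h
  exact neg_injective (strictMono_gaussianReal_Iic.injective h)

theorem gaussianQ_gaussianQInv {p : ℝ} (h0 : 0 < p) (h1 : p < 1) :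
    gaussianQ (gaussianQInv p) = p := by
  have hbot := tendsto_cdf_atBot (gaussianReal 0 1)
  have htop := tendsto_cdf_atTop (gaussianReal 0 1)
  simp only [funext (cdf_eq_real (gaussianReal 0 1))] at hbot htop
  obtain ⟨x, hx⟩ := mem_range_of_exists_le_of_exists_ge continuous_gaussianReal_Iic
    ((hbot.eventually_le_const h0).exists) ((htop.eventually_const_le h1).exists)
  refine Function.invFun_eq ⟨-x, ?_⟩
  rw [gaussianQ_eq_Iic_neg, neg_neg]
  exact hx

/-! ### Growth of the dispersion and the rate -/

namespace FTNSystem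

variable (S : FTNSystem)

/-- The total dispersion `∑ V_n` of the parallel channels, in squared nats. -/
noncomputable def totalDispersion (Ω : ℝ) : ℝ := ∑ n, (1 - 1 / (1 + 1 / S.noiseVar Ω n) ^ 2)

/-- The number of symbols and the total dispersion are both of the order of `Ω`. -/
theorem exists_dispersion_bounds : ∃ c₁ c₂ Ω₁ : ℝ, 0 < c₁ ∧ 0 < c₂ ∧ 0 < Ω₁ ∧ ∀ Ω, Ω₁ ≤ Ω →
    (∀ n, 0 < S.noiseVar Ω n) ∧ c₁ * Ω ≤ S.totalDispersion Ω ∧ S.totalDispersion Ω ≤ c₂ * Ω ∧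
      S.numSymbols Ω ≤ c₂ * Ω := by
  have hW := S.W_pos
  have hN0 := S.N0_pos
  have hP := S.P_pos
  have hT := S.Tp_pos
  have hsnr : 0 < S.snr := by unfold snr; positivity
  have hc : 0 < S.c := by unfold c; positivity
  set A := S.τ * (1 + S.β) with hA
  have hA0 : 0 < A := mul_pos S.τ_pos (by linarith [S.β_nonneg])
  set Λ : ℝ := 2 * ⌊S.Tp / S.spacing⌋₊ + 1 with hΛ
  have hΛ0 : 0 < Λ := by positivity
  set G := S.snr * (2 * A) * Λ with hG
  have hG0 : 0 < G := by positivity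
  -- `g_n = 1 / σ_n²` lies in `(0, G]` and has sum `ρ Ω`, and `V_n ≥ g_n / (1 + g_n)`
  refine ⟨S.snr / (1 + G), 2 / A, 2 * S.c + A, by positivity, by positivity, by positivity,
    fun Ω hΩ => ?_⟩
  have hΩ0 : 0 < Ω := by linarith
  set N := S.numSymbols Ω with hN
  have hq : 0 ≤ (Ω - S.c) / A := div_nonneg (by linarith) hA0.le
  have hNle : (N : ℝ) ≤ 2 / A * Ω := by
    have h1 : (N : ℝ) ≤ (Ω - S.c) / A + 1 := Nat.floor_le (by linarith)
    have h2 : (Ω - S.c) / A + 1 ≤ 2 / A * Ω := by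
      rw [div_add_one hA0.ne', div_mul_eq_mul_div]
      gcongr
      linarith
    linarith
  have hNge : Ω / (2 * A) ≤ N := by
    have h1 : (Ω - S.c) / A + 1 < N + 1 := Nat.lt_floor_add_one _
    have h2 : Ω / (2 * A) ≤ (Ω - S.c) / A := by
      rw [div_le_div_iff₀ (by positivity) hA0]
      nlinarith
    linarith
  have hN0' : (0 : ℝ) < N := lt_of_lt_of_le (by positivity) hNge
  have hratio : Ω / N ≤ 2 * A := by
    rw [div_le_iff₀ hN0']
    rw [div_le_iff₀ (by positivity)] at hNge
    linarith
  have hg : ∀ n, 1 / S.noiseVar Ω n = S.snr * (Ω / N) * S.eigenvalue N n := fun n => by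
    rw [noiseVar, one_div, inv_inv]
  have hgpos : ∀ n, 0 < S.snr * (Ω / N) * S.eigenvalue N n := fun n => by
    have := S.eigenvalue_pos N n
    positivity
  have hgle : ∀ n, S.snr * (Ω / N) * S.eigenvalue N n ≤ G := fun n => by
    have h1 := S.eigenvalue_le N n
    have h2 := (S.eigenvalue_pos N n).le
    rw [hG]
    gcongr
  refine ⟨fun n => inv_pos.mpr (hgpos n), ?_, ?_, hNle⟩
  · have hsum : S.snr / (1 + G) * Ω = ∑ n, S.snr * (Ω / N) * S.eigenvalue N n / (1 + G) := by
      rw [← Finset.sum_div, ← Finset.mul_sum, S.sum_eigenvalue]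
      field_simp
    rw [hsum, totalDispersion]
    refine Finset.sum_le_sum fun n _ => ?_
    rw [hg]
    set g := S.snr * (Ω / N) * S.eigenvalue N n
    have hg0 : 0 < g := hgpos n
    calc g / (1 + G) ≤ g / (1 + g) := by
          have := hgle n
          gcongr
      _ = 1 - 1 / (1 + g) := by field_simp; ring
      _ ≤ 1 - 1 / (1 + g) ^ 2 := by
          have : 1 + g ≤ (1 + g) ^ 2 := by nlinarith
          gcongr
  · refine le_trans ?_ hNle
    have : S.totalDispersion Ω ≤ ∑ n : Fin N, (1 : ℝ) := by
      refine Finset.sum_le_sum fun n _ => ?_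
      have : 0 ≤ 1 / (1 + 1 / S.noiseVar Ω n) ^ 2 := by positivity
      linarith
    simpa using this

theorem capacityNA_eq (Ω : ℝ) :
    S.capacityNA Ω = (∑ n, Real.log (1 + 1 / S.noiseVar Ω n)) / (Real.log 2 * Ω) := by
  unfold capacityNA Real.logb
  rw [← Finset.sum_div]
  field_simp

theorem sqrt_dispersionNA_div {Ω : ℝ} (hΩ : 0 < Ω) :
    √(S.dispersionNA Ω / Ω) = √(S.totalDispersion Ω) / Ω := by
  have : S.dispersionNA Ω / Ω = S.totalDispersion Ω / Ω ^ 2 := by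
    unfold dispersionNA totalDispersion
    field_simp
  rw [this, Real.sqrt_div' _ (by positivity), Real.sqrt_sq hΩ.le]

theorem rateNA_eq {Ω : ℝ} (hΩ : 0 < Ω) (Pe : ℝ) :
    S.rateNA Ω Pe = (∑ n, Real.log (1 + 1 / S.noiseVar Ω n)
      - √(S.totalDispersion Ω) * gaussianQInv Pe + Real.log Ω / 2) / (Real.log 2 * Ω) := by
  have h2 : 0 < Real.log 2 := Real.log_pos (by norm_num)
  rw [rateNA, capacityNA_eq, sqrt_dispersionNA_div S hΩ]
  unfold Real.logb
  rw [Real.log_exp]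
  field_simp

/-- Exchanging the rate and the block error rate in the normal approximation. -/
theorem eq_rateNA_iff {Ω Pe : ℝ} (hΩ : 0 < Ω) (hV : 0 < S.totalDispersion Ω) (h0 : 0 < Pe)
    (h1 : Pe < 1) (R : ℝ) : R = S.rateNA Ω Pe ↔
      Pe = gaussianQ ((S.capacityNA Ω - R + Real.logb 2 Ω / (2 * Ω)) /
        (√(S.dispersionNA Ω / Ω) * Real.logb 2 (Real.exp 1))) := by
  have hD : 0 < √(S.dispersionNA Ω / Ω) * Real.logb 2 (Real.exp 1) := by
    rw [sqrt_dispersionNA_div S hΩ]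
    have h2 : 0 < Real.logb 2 (Real.exp 1) :=
      Real.logb_pos (by norm_num) (Real.one_lt_exp_iff.mpr one_pos)
    have := Real.sqrt_pos.mpr hV
    positivity
  have hQ := gaussianQ_gaussianQInv h0 h1
  rw [rateNA]
  set D := √(S.dispersionNA Ω / Ω) * Real.logb 2 (Real.exp 1)
  constructor
  · intro hR
    rw [← hQ]
    congr 1
    rw [eq_div_iff hD.ne', hR]
    ring
  · intro hP
    have h3 : gaussianQInv Pe = (S.capacityNA Ω - R + Real.logb 2 Ω / (2 * Ω)) / D :=
      gaussianQ_injective (hQ.trans hP)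
    rw [eq_div_iff hD.ne'] at h3
    linarith

end FTNSystem

theorem proposition1 (S : FTNSystem) (Pe : ℝ) (hPe0 : 0 < Pe) (hPe1 : Pe < 1) :
    ∃ K Ω₀ : ℝ, 0 < Ω₀ ∧ ∀ Ω : ℝ, Ω₀ ≤ Ω →
      S.maxCodingRate Ω Pe ≤ ((S.rateNA Ω Pe + K / Ω : ℝ) : EReal) ∧
      ∀ R : ℝ, R = S.rateNA Ω Pe ↔
        Pe = gaussianQ ((S.capacityNA Ω - R + Real.logb 2 Ω / (2 * Ω)) /
          (√(S.dispersionNA Ω / Ω) * Real.logb 2 (Real.exp 1))) := by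
  obtain ⟨c₁, c₂, Ω₁, hc₁, hc₂, hΩ₁, hbd⟩ := S.exists_dispersion_bounds
  have hK0 := infoThirdMoment_nonneg
  set x₀ := -gaussianQInv Pe with hx₀
  have hΦ : (gaussianReal 0 1).real (Set.Iic x₀) = Pe := by
    rw [hx₀, ← gaussianQ_eq_Iic_neg, gaussianQ_gaussianQInv hPe0 hPe1]
  -- `B / √Ω` bounds the sum of the third moments of the normalized information densities, so the
  -- Berry–Esseen error is at most `25 * B / √Ω`
  set B := c₂ * (infoThirdMoment + 1) / √c₁ ^ 3 with hB
  have hs₁ : 0 < √c₁ := Real.sqrt_pos.mpr hc₁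
  have hB0 : 0 < B := by positivity
  -- near `x₀` the normal distribution function has slope at least `m`
  set m := gaussianPDFReal 0 1 (|x₀| + 1) with hm
  have hm0 : 0 < m := gaussianPDFReal_pos 0 1 _ one_ne_zero
  -- moving `x₀` by `d / √Ω` outweighs that error and leaves `1 / √Ω` of probability to spare
  set d := (25 * B + 1) / m with hd
  have hd0 : 0 < d := by positivity
  have hl2 : 0 < Real.log 2 := Real.log_pos (by norm_num)
  refine ⟨d * √c₂ / Real.log 2, Ω₁ + d ^ 2, by positivity, fun Ω hΩ => ?_⟩
  have hΩ1 : Ω₁ ≤ Ω := by nlinarith [sq_nonneg d]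
  have hΩ0 : 0 < Ω := by linarith
  obtain ⟨hσ, hVlow, hVup, hN⟩ := hbd Ω hΩ1
  have hV : 0 < S.totalDispersion Ω := lt_of_lt_of_le (by positivity) hVlow
  refine ⟨?_, S.eq_rateNA_iff hΩ0 hV hPe0 hPe1⟩
  have hr : 0 < √Ω := Real.sqrt_pos.mpr hΩ0
  have hrr : √Ω * √Ω = Ω := Real.mul_self_sqrt hΩ0.le
  have hdle : d / √Ω ≤ 1 := by
    rw [div_le_one hr]
    exact Real.le_sqrt_of_sq_le (by linarith)
  have h3 : S.numSymbols Ω * infoThirdMoment ≤ B / √Ω * √(S.totalDispersion Ω) ^ 3 := by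
    have hsV : √c₁ * √Ω ≤ √(S.totalDispersion Ω) := by
      rw [← Real.sqrt_mul hc₁.le]
      exact Real.sqrt_le_sqrt hVlow
    calc (S.numSymbols Ω : ℝ) * infoThirdMoment ≤ c₂ * Ω * (infoThirdMoment + 1) := by
          gcongr
          linarith
      _ = B / √Ω * (√c₁ * √Ω) ^ 3 := by
          rw [hB]
          field_simp
          rw [sq, hrr]
      _ ≤ _ := by gcongr
  have hu : Pe + 1 / √Ω + 25 * (B / √Ω) ≤ (gaussianReal 0 1).real (Set.Iic (x₀ + d / √Ω)) := by
    have hpos : 0 ≤ d / √Ω := by positivity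
    have h4 := gaussianReal_Iic_add_Ioc (show x₀ ≤ x₀ + d / √Ω by linarith)
    have h5 := le_gaussianReal_Ioc (show x₀ ≤ x₀ + d / √Ω by linarith) (r := |x₀| + 1)
      (by linarith [neg_abs_le x₀]) (by linarith [le_abs_self x₀])
    rw [add_sub_cancel_left, ← hm] at h5
    have h6 : m * (d / √Ω) = 1 / √Ω + 25 * (B / √Ω) := by
      rw [hd]; field_simp; ring
    linarith
  refine sSup_le ?_
  rintro _ ⟨M, C, hC, rfl⟩
  have hlog := C.log_card_le_of_bler_le hσ hV rfl (by positivity : 0 < B / √Ω) h3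
    (by positivity : 0 < 1 / √Ω) hu hC
  rw [EReal.coe_le_coe_iff, S.rateNA_eq hΩ0]
  have hη : Real.log (1 / √Ω) = -(Real.log Ω / 2) := by
    rw [one_div, Real.log_inv, Real.log_sqrt hΩ0.le]
  have hVd : √(S.totalDispersion Ω) * (d / √Ω) ≤ d * √c₂ := by
    have : √(S.totalDispersion Ω) ≤ √c₂ * √Ω := by
      rw [← Real.sqrt_mul hc₂.le]
      exact Real.sqrt_le_sqrt hVup
    calc √(S.totalDispersion Ω) * (d / √Ω) ≤ √c₂ * √Ω * (d / √Ω) := by gcongr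
      _ = d * √c₂ := by field_simp
  rw [div_div, ← add_div, Real.logb, div_div]
  gcongr
  rw [hη, mul_add, hx₀] at hlog
  linarith
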